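/- An alternating sign matrix (ASM) is a square matrix with entries in $\{0,1,-1\}$ such that along each row and each column the nonzero entries alternate in sign and have sum $1$; let $\mathrm{ASM}(n)$ be the set of all $n\times n$ ASMs. In an ASM, each of the first and last rows and columns contains a single $1$ and otherwise only $0$'s. For $A\in\mathrm{ASM}(n)$ let $$\nu(A)=\sum_{1\le i<i'\le n,\;1\le j'\le j\le n}A_{ij}A_{i'j'},\qquad \mu(A)=\text{number of $-1$'s in }A,$$ (where $\nu(A)$ is a nonnegative integer), and let $\rho_T(A),\rho_R(A),\rho_B(A),\rho_L(A)$ be, respectively, the number of $0$'s to the left of the $1$ in the top row, below the $1$ in the right-most column, to the right of the $1$ in the bottom row, and above the $1$ in the left-most column of $A$. Define $$Z^{\mathrm{quad}}_n(x,y;z_1,z_2,z_3,z_4)=\sum_{A\in\mathrm{ASM}(n)}x^{\nu(A)}y^{\mu(A)}z_1^{\rho_T(A)}z_2^{\rho_R(A)}z_3^{\rho_B(A)}z_4^{\rho_L(A)},$$ $$Z^{\mathrm{tri}}_n(x,y;z_1,z_2,z_3)=Z^{\mathrm{quad}}_n(x,y;z_1,1,z_2,z_3),\qquad Z^{\mathrm{adj}}_n(x,y;z_1,z_2)=Z^{\mathrm{quad}}_n(x,y;z_1,1,1,z_2).$$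 Then the following polynomial identities in the indeterminates $x,z_1,z_2,z_3,z_4$ hold (equivalently, they hold for all elements $x,z_1,\dots,z_4$ of every commutative ring). (1) For all $n\ge 2$, $$\begin{aligned} &(xz_4z_1+z_4+z_1-1)(xz_1z_2-xz_1-xz_2-1)(xz_2z_3+z_2+z_3-1)(xz_3z_4-xz_3-xz_4-1)\,Z^{\mathrm{quad}}_n(x,x+1;z_1,z_2,z_3,z_4)\\ &=z_1z_2z_3z_4(xz_1z_3+1)(xz_2z_4+1)\bigl((xz_1+1)(xz_2+1)(xz_3+1)(xz_4+1)\bigr)^{n-2}(x+1)^{(n-4)(n-5)/2}\\ &\quad-\Bigl((z_2-1)(z_3-1)z_4z_1\bigl((xz_4+1)(xz_1+1)\bigr)^{n-2}+(z_4-1)(z_1-1)z_2z_3\bigl((xz_2+1)(xz_3+1)\bigr)^{n-2}\Bigr)\\ &\qquad\times(xz_1z_2-xz_1-xz_2-1)(xz_3z_4-xz_3-xz_4-1)(x+1)^{(n-3)(n-4)/2}\\ &\quad-\Bigl((z_3-1)(z_4-1)z_1z_2(z_3z_4)^{n-1}\bigl((xz_1+1)(xz_2+1)\bigr)^{n-2}+(z_1-1)(z_2-1)z_3z_4(z_1z_2)^{n-1}\bigl((xz_3+1)(xz_4+1)\bigr)^{n-2}\Bigr)\\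 &\qquad\times(xz_4z_1+z_4+z_1-1)(xz_2z_3+z_2+z_3-1)\,x^n(x+1)^{(n-3)(n-4)/2}\\ &\quad+(z_1-1)(z_2-1)(z_3-1)(z_4-1)\Bigl((xz_1z_2-xz_1-xz_2-1)(xz_3z_4-xz_3-xz_4-1)\\ &\qquad+(xz_4z_1+z_4+z_1-1)(xz_2z_3+z_2+z_3-1)(z_1z_2z_3z_4)^{n-1}x^{2n-1}\Bigr)(x+1)^{(n-2)(n-3)/2}. \end{aligned}$$ (2) For all $n\ge 2$, $$\begin{aligned} &(xz_1z_3+z_1+z_3-1)(xz_2z_3-xz_2-xz_3-1)\,Z^{\mathrm{tri}}_n(x,x+1;z_1,z_2,z_3)\\ &=-z_1z_3(xz_1z_2+1)\bigl((xz_1+1)(xz_2+1)\bigr)^{n-2}(xz_3+1)^{n-1}(x+1)^{(n-3)(n-4)/2}\\ &\quad+(z_2-1)(z_3-1)(xz_1z_3+z_1+z_3-1)z_1(z_2z_3)^{n-1}(xz_1+1)^{n-2}x^n(x+1)^{(n-2)(n-3)/2}\\ &\quad-(z_1-1)(z_3-1)(xz_2z_3-xz_2-xz_3-1)(xz_2+1)^{n-2}(x+1)^{(n-2)(n-3)/2}.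 \end{aligned}$$ (3) For all $n\ge 1$, $$(xz_1z_2+z_1+z_2-1)\,Z^{\mathrm{adj}}_n(x,x+1;z_1,z_2)=z_1z_2\bigl((xz_1+1)(xz_2+1)\bigr)^{n-1}(x+1)^{(n-2)(n-3)/2}-(z_1-1)(z_2-1)(x+1)^{(n-1)(n-2)/2}.$$ -/

import Mathlib

open Finset BigOperators

namespace AltSign

/-- Along the vector `v` the nonzero entries alternate in sign and have sum `1`: any two
consecutive nonzero entries (those with only zeros between them) are opposite. -/
def AlternatesToOne {n : ℕ} (v : Fin n → ℤ) : Prop :=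
  (∀ j k : Fin n, j < k → v j ≠ 0 → v k ≠ 0 → (∀ l : Fin n, j < l → l < k → v l = 0) →
    v k = -v j) ∧
  ∑ j, v j = 1

/-- Alternating sign matrices: the matrix with entry `A i j` in row `i` and column `j` has
all entries equal to `0`, `1` or `-1`, and along each row and each column the nonzero entries
alternate in sign and have sum `1`. -/
def IsASM {n : ℕ} (A : Fin n → Fin n → ℤ) : Prop :=
  (∀ i j, A i j = 0 ∨ A i j = 1 ∨ A i j = -1) ∧
  (∀ i, AlternatesToOne (fun j => A i j)) ∧
  (∀ j, AlternatesToOne (fun i => A i j))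

instance {n : ℕ} (v : Fin n → ℤ) : Decidable (AlternatesToOne v) := by
  unfold AlternatesToOne; infer_instance

instance {n : ℕ} (A : Fin n → Fin n → ℤ) : Decidable (IsASM A) := by
  unfold IsASM; infer_instance

/-- The finite set of all `n × n` alternating sign matrices. -/
def ASM (n : ℕ) : Finset (Fin n → Fin n → ℤ) :=
  Finset.filter (fun A => IsASM A)
    (Fintype.piFinset fun _ : Fin n => Fintype.piFinset fun _ : Fin n => ({0, 1, -1} : Finset ℤ))

theorem mem_ASM {n : ℕ} (A : Fin n → Fin n → ℤ) : A ∈ ASM n ↔ IsASM A := by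
  unfold ASM
  rw [Finset.mem_filter, and_iff_right_iff_imp]
  intro h
  simpa [Fintype.mem_piFinset] using h.1

/-- The number of generalized inversions, as an integer: the sum of `A i j * A i' j'`
over `i < i'` and `j' ≤ j`. -/
def nuInt {n : ℕ} (A : Fin n → Fin n → ℤ) : ℤ :=
  ∑ i, ∑ i', ∑ j, ∑ j', if i < i' ∧ j' ≤ j then A i j * A i' j' else 0

/-- The number of generalized inversions of an alternating sign matrix, as a natural number.
(For an alternating sign matrix `nuInt A` is nonnegative, being a sum of products of a partial
column sum and a partial row sum, each of which is `0` or `1`; so nothing is truncated.) -/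
def nu {n : ℕ} (A : Fin n → Fin n → ℤ) : ℕ := (nuInt A).toNat

/-- The number of entries `-1`. -/
def mu {n : ℕ} (A : Fin n → Fin n → ℤ) : ℕ :=
  #{p : Fin n × Fin n | A p.1 p.2 = -1}

/-- The number of `0`s to the left of the `1` in the top row. -/
def rhoT {n : ℕ} (A : Fin n → Fin n → ℤ) : ℕ :=
  #{j : Fin n | ∃ i k : Fin n, (i : ℕ) = 0 ∧ j < k ∧ A i j = 0 ∧ A i k = 1}

/-- The number of `0`s below the `1` in the right-most column. -/
def rhoR {n : ℕ} (A : Fin n → Fin n → ℤ) : ℕ :=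
  #{i : Fin n | ∃ j k : Fin n, (j : ℕ) + 1 = n ∧ k < i ∧ A i j = 0 ∧ A k j = 1}

/-- The number of `0`s to the right of the `1` in the bottom row. -/
def rhoB {n : ℕ} (A : Fin n → Fin n → ℤ) : ℕ :=
  #{j : Fin n | ∃ i k : Fin n, (i : ℕ) + 1 = n ∧ k < j ∧ A i j = 0 ∧ A i k = 1}

/-- The number of `0`s above the `1` in the left-most column. -/
def rhoL {n : ℕ} (A : Fin n → Fin n → ℤ) : ℕ :=
  #{i : Fin n | ∃ j k : Fin n, (j : ℕ) = 0 ∧ i < k ∧ A i j = 0 ∧ A k j = 1}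

/-- The quadruply-refined generating function of alternating sign matrices. The arguments are
elements of an arbitrary commutative ring, for example the indeterminates of a polynomial ring. -/
def Zqua {R : Type*} [CommRing R] (n : ℕ) (x y z₁ z₂ z₃ z₄ : R) : R :=
  ∑ A ∈ ASM n, x ^ nu A * y ^ mu A * z₁ ^ rhoT A * z₂ ^ rhoR A * z₃ ^ rhoB A * z₄ ^ rhoL A

/-- The triply-refined generating function (top, bottom and left boundaries). -/
def Ztri {R : Type*} [CommRing R] (n : ℕ) (x y z₁ z₂ z₃ : R) : R :=
  Zqua n x y z₁ 1 z₂ z₃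

/-- The adjacent-boundary doubly-refined generating function (top and left boundaries). -/
def Zadj {R : Type*} [CommRing R] (n : ℕ) (x y z₁ z₂ : R) : R :=
  Zqua n x y z₁ 1 1 z₂

/-- The natural number `a (a - 1) / 2`, for any integer `a` (possibly negative). -/
def halfProd (a : ℤ) : ℕ := (a * (a - 1) / 2).toNat

theorem two_mul_halfProd (a : ℤ) : 2 * (halfProd a : ℤ) = a * (a - 1) := by
  have h0 : 0 ≤ a * (a - 1) := by
    rcases le_or_gt a 0 with h | h
    · exact mul_nonneg_of_nonpos_of_nonpos h (by omega)
    · exact mul_nonneg h.le (by omega)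
  have h2 : (2 : ℤ) ∣ a * (a - 1) := (Int.even_mul_pred_self a).two_dvd
  unfold halfProd
  generalize a * (a - 1) = b at h0 h2
  omega

end AltSign

open Finset BigOperators

namespace AltSign

/-! Attach nonzero weights M_ij to the positions and sum x^ν (1+x)^μ ∏ M_ij^{A_ij} over all
alternating sign matrices of size n. This is the λ-determinant of Robbins and Rumsey, and it obeys a
Dodgson condensation (`sum_ASM_condensation`): the sum of size m+2 times the central one of size m
equals NW·SE + x·NE·SW, the four factors being the corner sums of size m+1.

To apply it, let M be 1 inside and carry powers of the z_i on the boundary (`boundaryWeight`). Each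
corner block sees only the two boundaries that it touches, so `Zqua_condensation` expresses the
quadruply-refined function through doubly-refined ones. Specializing some z_i to 1 gives first-order
recursions, solved in turn for no boundary (`Zqua_ones`), one (`Zqua_single`) and two
(`Zqua_adjacent`, `Zqua_opposite`). Three and four boundaries then follow algebraically
(`Zqua_triple`, `Zqua_quadruple`).

For the condensation itself, the column sums of the first k rows are indicators of k-element sets,
and these sets form a monotone triangle. Because y = x+1, the weight of a row factors over the
entries of the triangle (`row_weight_eq`), each contributing 1, x or 1+x. Summing out the rows by
multilinearity turns the sum into a determinant (`triangleSum_eq_det`). When the bottom row is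
consecutive, one more summation can be left undone (`triangleSum_consecutive`). The six sums in the
condensation thereby become minors built from a single array, and the claim is `det_three_term`, a
form of Desnanot–Jacobi.

The argument divides by x, x+1 and the z_i. It is therefore run in the fraction field of ℤ[x, z₁, …,
z₄], and the resulting polynomial identities are specialized to any commutative ring. -/

variable {K : Type*} [Field K]

/-! ### Determinant identities -/

open Matrix in
/-- Jacobi's complementary minor theorem, for the block of an adjugate. -/
theorem det_mul_det_adjugate_toBlocks₁₁ {R m n : Type*} [CommRing R] [Fintype m] [Fintype n]
    [DecidableEq m] [DecidableEq n] (A : Matrix (m ⊕ n) (m ⊕ n) R) :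
    A.det * A.adjugate.toBlocks₁₁.det = A.det ^ Fintype.card m * A.toBlocks₂₂.det := by
  have hA : A * A.adjugate = A.det • (1 : Matrix (m ⊕ n) (m ⊕ n) R) := mul_adjugate A
  have h11 : A.toBlocks₁₁ * A.adjugate.toBlocks₁₁ + A.toBlocks₁₂ * A.adjugate.toBlocks₂₁ =
      A.det • 1 := by
    ext i j
    have := congrFun (congrFun hA (Sum.inl i)) (Sum.inl j)
    simpa [Matrix.mul_apply, Fintype.sum_sum_type, toBlocks₁₁, toBlocks₁₂, toBlocks₂₁,
      Matrix.one_apply] using this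
  have h21 : A.toBlocks₂₁ * A.adjugate.toBlocks₁₁ + A.toBlocks₂₂ * A.adjugate.toBlocks₂₁ = 0 := by
    ext i j
    have := congrFun (congrFun hA (Sum.inr i)) (Sum.inl j)
    simpa [Matrix.mul_apply, Fintype.sum_sum_type, toBlocks₁₁, toBlocks₂₂, toBlocks₂₁,
      Matrix.one_apply] using this
  -- Replacing the second block column of the adjugate by that of the identity makes the product
  -- block triangular, and both determinants can be read off.
  have key : A * fromBlocks A.adjugate.toBlocks₁₁ 0 A.adjugate.toBlocks₂₁ 1 =
      fromBlocks (A.det • 1) A.toBlocks₁₂ 0 A.toBlocks₂₂ := by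
    rw [← h11, ← h21]
    conv_lhs => lhs; rw [← fromBlocks_toBlocks A]
    rw [fromBlocks_multiply]
    simp
  have := congrArg det key
  rw [det_mul, det_fromBlocks_zero₁₂, det_fromBlocks_zero₂₁, det_smul, det_one, det_one] at this
  simpa using this

/-- Splits off the first and the last index. -/
noncomputable def endsEquiv (m : ℕ) : Fin 2 ⊕ Fin m ≃ Fin (m + 2) :=
  Equiv.ofBijective (Sum.elim ![0, Fin.last (m + 1)] fun i => i.castSucc.succ) <| by
    rw [Fintype.bijective_iff_injective_and_card]
    refine ⟨?_, by simp [add_comm]⟩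
    rintro (i | i) (j | j) h
    · fin_cases i <;> fin_cases j <;> simp_all [Fin.ext_iff]
    · fin_cases i <;> simp [Fin.ext_iff] at h; omega
    · fin_cases j <;> simp [Fin.ext_iff] at h; omega
    · simpa [Fin.ext_iff] using h

/-- Jacobi's theorem for the first and last index: the corner entries of the adjugate are the four
minors of size m+1, up to signs. Nonvanishing of the determinant allows one factor to be cancelled.
-/
theorem desnanot_jacobi_of_det_ne_zero {R : Type*} [CommRing R] [IsDomain R] {m : ℕ}
    (A : Matrix (Fin (m + 2)) (Fin (m + 2)) R) (hA : A.det ≠ 0) :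
    A.det * (A.submatrix (fun i : Fin m => i.castSucc.succ) fun i => i.castSucc.succ).det =
      (A.submatrix Fin.succ Fin.succ).det * (A.submatrix Fin.castSucc Fin.castSucc).det -
      (A.submatrix Fin.succ Fin.castSucc).det * (A.submatrix Fin.castSucc Fin.succ).det := by
  apply mul_left_cancel₀ hA
  have := det_mul_det_adjugate_toBlocks₁₁ (A.submatrix (endsEquiv m) (endsEquiv m))
  rw [Matrix.det_submatrix_equiv_self, Matrix.adjugate_submatrix_equiv_self, Matrix.det_fin_two,
    Fintype.card_fin, sq, mul_assoc] at this
  have h22 : (A.submatrix (endsEquiv m) (endsEquiv m)).toBlocks₂₂ =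
    A.submatrix (fun i : Fin m => i.castSucc.succ) fun i => i.castSucc.succ := rfl
  rw [← h22, ← this]
  congr 1
  have h0 : endsEquiv m (Sum.inl 0) = 0 := rfl
  have h1 : endsEquiv m (Sum.inl 1) = Fin.last (m + 1) := rfl
  simp only [Matrix.toBlocks₁₁, Matrix.submatrix_apply, Matrix.of_apply, h0, h1,
    Matrix.adjugate_fin_succ_eq_det_submatrix, Fin.succAbove_last, Fin.succAbove_zero]
  have hs : (-1 : R) ^ (m + 1) * (-1) ^ (m + 1) = 1 := by
    rw [← mul_pow]; simp
  simp only [Fin.val_last, Fin.val_zero, add_zero, zero_add, pow_zero, pow_add _ (m + 1) (m + 1)]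
  generalize (A.submatrix Fin.succ Fin.succ).det = a
  generalize (A.submatrix Fin.castSucc Fin.castSucc).det = b
  generalize (A.submatrix Fin.succ Fin.castSucc).det = c
  generalize (A.submatrix Fin.castSucc Fin.succ).det = d
  linear_combination (a * b - c * d) * hs

/-- The Desnanot–Jacobi identity. -/
theorem desnanot_jacobi {R : Type*} [CommRing R] {m : ℕ}
    (A : Matrix (Fin (m + 2)) (Fin (m + 2)) R) :
    A.det * (A.submatrix (fun i : Fin m => i.castSucc.succ) fun i => i.castSucc.succ).det =
      (A.submatrix Fin.succ Fin.succ).det * (A.submatrix Fin.castSucc Fin.castSucc).det -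
      (A.submatrix Fin.succ Fin.castSucc).det * (A.submatrix Fin.castSucc Fin.succ).det := by
  -- The generic matrix over ℤ has nonzero determinant, and every matrix is a specialization of it.
  have h := congrArg (MvPolynomial.aeval fun p : Fin (m + 2) × Fin (m + 2) => A p.1 p.2)
    (desnanot_jacobi_of_det_ne_zero _ (Matrix.det_mvPolynomialX_ne_zero (Fin (m + 2)) ℤ))
  have hX (k : ℕ) (f g : Fin k → Fin (m + 2)) :
      MvPolynomial.aeval (fun p : Fin (m + 2) × Fin (m + 2) => A p.1 p.2)
        ((Matrix.mvPolynomialX (Fin (m + 2)) (Fin (m + 2)) ℤ).submatrix f g).det =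
      (A.submatrix f g).det := by
    rw [AlgHom.map_det]
    congr 1
    ext i j
    simp
  rw [map_mul, map_sub, map_mul, map_mul, hX, hX, hX, hX, hX] at h
  have h0 := hX _ id id
  rw [Matrix.submatrix_id_id, Matrix.submatrix_id_id] at h0
  rwa [h0] at h

/-- Column reduction of a matrix whose first row is a multiplicative chain. -/
theorem det_eq_of_first_row {R : Type*} [CommRing R] {k : ℕ}
    (A : Matrix (Fin (k + 1)) (Fin (k + 1)) R) (c : Fin k → R)
    (h : ∀ j, A 0 j.succ = c j * A 0 j.castSucc) :
    A.det = A 0 0 *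
      (Matrix.of fun a b : Fin k => A a.succ b.succ - c b * A a.succ b.castSucc).det := by
  let B : Matrix (Fin (k + 1)) (Fin (k + 1)) R :=
    Matrix.of fun i => Fin.cons (A i 0) fun j => A i j.succ - c j * A i j.castSucc
  rw [Matrix.det_eq_of_forall_col_eq_smul_add_pred (B := B) c (fun i => by simp [B])
    (fun i j => by simp [B]), Matrix.det_succ_row_zero, Finset.sum_eq_single 0]
  · simp only [Fin.val_zero, pow_zero, one_mul, Fin.succAbove_zero]
    rfl
  · intro j _ hj
    obtain ⟨j, rfl⟩ := Fin.exists_succ_eq.2 hj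
    simp [B, h]
  · simp

/-- A three-term relation between minors of a matrix whose columns are combined in pairs. -/
theorem det_three_term {R : Type*} [CommRing R] (v : ℕ → ℕ → R) (y : R) (m : ℕ) :
    (Matrix.of fun a b : Fin (m + 1) => v a (b + 1) - y * v a b).det *
        (Matrix.of fun a b : Fin m => v a (b + 1)).det =
      (Matrix.of fun a b : Fin (m + 1) => v a (b + 1)).det *
          (Matrix.of fun a b : Fin m => v a (b + 1) - y * v a b).det -
        y * ((Matrix.of fun a b : Fin (m + 1) => v a b).det *
          (Matrix.of fun a b : Fin m => v a (b + 2) - y * v a (b + 1)).det) := by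
  -- Border the array by the row 1, y, y², …. Minors containing this row reduce to the paired
  -- columns, and the others are plain minors; the factor y in the claim is the leading entry of a
  -- border row that starts at the second column.
  let A : Matrix (Fin (m + 2)) (Fin (m + 2)) R :=
    Matrix.of fun i j => Fin.cases (y ^ (j : ℕ)) (fun a : Fin (m + 1) => v a j) i
  have hD := desnanot_jacobi A
  have hA : A.det = (Matrix.of fun a b : Fin (m + 1) => v a (b + 1) - y * v a b).det := by
    rw [det_eq_of_first_row A (fun _ => y) (fun j => by simp [A, pow_succ'])]
    simp [A]
  have h1 : (A.submatrix Fin.castSucc Fin.castSucc).det =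
      (Matrix.of fun a b : Fin m => v a (b + 1) - y * v a b).det := by
    rw [det_eq_of_first_row _ (fun _ => y) (fun j => by simp [A, pow_succ'])]
    simp [A]
  have h2 : (A.submatrix Fin.castSucc Fin.succ).det =
      y * (Matrix.of fun a b : Fin m => v a (b + 2) - y * v a (b + 1)).det := by
    rw [det_eq_of_first_row _ (fun _ => y) (fun j => by simp [A, pow_succ'])]
    simp [A]
  rw [hA, h1, h2] at hD
  have h3 : A.submatrix (fun i : Fin m => i.castSucc.succ) (fun i => i.castSucc.succ) =
    Matrix.of fun a b : Fin m => v a (b + 1) := by ext; simp [A]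
  have h4 : A.submatrix Fin.succ Fin.succ = Matrix.of fun a b : Fin (m + 1) => v a (b + 1) := by
    ext; simp [A]
  have h5 : A.submatrix Fin.succ Fin.castSucc = Matrix.of fun a b : Fin (m + 1) => v a b := by
    ext; simp [A]
  rw [h3, h4, h5] at hD
  rw [hD]; ring

/-! ### Weighted monotone triangles as determinants -/

/-- The weight of an entry `t` of a monotone triangle lying above the entries `p < q`. -/
def interlaceWeight (x : K) (p q t : ℕ) : K :=
  if t = p then 1 else if t = q then x else 1 + x

/-- The weighted sum over monotone triangles with bottom row `t`, with weights `M` of the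
entries. -/
def triangleSum (x : K) (M : ℕ → ℕ → K) : (k : ℕ) → (Fin k → ℕ) → K
  | 0, _ => 1
  | k + 1, t' => ∑ t ∈ Fintype.piFinset (fun b : Fin k => Icc (t' b.castSucc) (t' b.succ)) with
      StrictMono t, (∏ b, interlaceWeight x (t' b.castSucc) (t' b.succ) (t b)) *
        ((∏ b, M k (t' b)) * ∏ b, (M k (t b))⁻¹) * triangleSum x M k t

/-- The rows of the matrix whose minors are the sums over monotone triangles. -/
def triangleRow (x : K) (M : ℕ → ℕ → K) : ℕ → ℕ → ℕ → K
  | 0, _, _ => 0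
  | k + 1, 0, u => M k u
  | k + 1, a + 1, u => M k u * (∑ j ∈ range u, (1 + x) * (triangleRow x M k a j * (M k j)⁻¹) +
      x * (triangleRow x M k a u * (M k u)⁻¹))

/-- Row `a` at level `k` involves only the weights with indices from `k - 1 - a` to `k - 1`.
Shifting the weights thus leaves the same array with one row fewer, which lets shifted and unshifted
sums be compared as minors of one array. -/
theorem triangleRow_shift (x : K) (M : ℕ → ℕ → K) {k a : ℕ} (h : a < k) (u : ℕ) :
    triangleRow x (fun i => M (i + 1)) k a u = triangleRow x M (k + 1) a u := by
  induction k generalizing a u with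
  | zero => omega
  | succ k ih =>
    cases a with
    | zero => rfl
    | succ a =>
      rw [triangleRow, triangleRow]
      simp only [ih (Nat.lt_of_succ_lt_succ h)]

/-- After removal of the factors `M k`, the row of index 0 is constant 1 and the others are discrete
antiderivatives of the rows one level down. Subtracting adjacent columns gives, between p and q, the
terms (1+x)g(j) for p ≤ j < q plus x g(q) - x g(p), which is exactly the interlacing sum with
weights 1, 1+x, …, 1+x, x. -/
theorem det_triangleRow_succ (x : K) (M : ℕ → ℕ → K) (k : ℕ) (t : Fin (k + 1) → ℕ)
    (ht : StrictMono t) :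
    (Matrix.of fun a b : Fin (k + 1) => triangleRow x M (k + 1) a (t b)).det =
      (∏ b, M k (t b)) * (Matrix.of fun a b : Fin k =>
        ∑ j ∈ Icc (t b.castSucc) (t b.succ), interlaceWeight x (t b.castSucc) (t b.succ) j *
          (triangleRow x M k a j * (M k j)⁻¹)).det := by
  let A : Matrix (Fin (k + 1)) (Fin (k + 1)) K := Matrix.of fun i b => Fin.cases 1
    (fun a : Fin k => ∑ j ∈ range (t b), (1 + x) * (triangleRow x M k a j * (M k j)⁻¹) +
      x * (triangleRow x M k a (t b) * (M k (t b))⁻¹)) i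
  have h1 : (Matrix.of fun a b : Fin (k + 1) => triangleRow x M (k + 1) a (t b)) =
      Matrix.of fun i j => M k (t j) * A i j := by
    ext i j
    refine Fin.cases ?_ (fun a => ?_) i
    · simp [A, triangleRow]
    · simp [A, triangleRow]
  rw [h1, Matrix.det_mul_row, det_eq_of_first_row A (fun _ => 1) (fun j => by simp [A])]
  congr 1
  rw [show A 0 0 = 1 from rfl, one_mul]
  congr 1
  ext a b
  have hlt : t b.castSucc < t b.succ := ht b.castSucc_lt_succ
  simp only [A, Matrix.of_apply, Fin.cases_succ, one_mul]
  generalize t b.castSucc = p at hlt ⊢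
  generalize t b.succ = q at hlt ⊢
  generalize (fun j => triangleRow x M k a j * (M k j)⁻¹) = g
  rw [← Finset.sum_range_add_sum_Ico _ hlt.le, Finset.sum_eq_sum_Ico_succ_bot hlt,
    ← Finset.Ico_succ_right_eq_Icc, Nat.succ_eq_succ, Finset.sum_Ico_succ_top hlt.le,
    Finset.sum_eq_sum_Ico_succ_bot hlt]
  have : ∑ j ∈ Ico (p + 1) q, interlaceWeight x p q j * (triangleRow x M k a j * (M k j)⁻¹) =
      ∑ j ∈ Ico (p + 1) q, (1 + x) * (triangleRow x M k a j * (M k j)⁻¹) := by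
    refine Finset.sum_congr rfl fun j hj => ?_
    rw [Finset.mem_Ico] at hj
    rw [interlaceWeight, if_neg (by omega), if_neg (by omega)]
  rw [this, interlaceWeight, interlaceWeight, if_pos rfl, if_neg (by omega), if_pos rfl]
  ring

/-- Induction on the rows: expand the determinant of column sums by multilinearity, so that choosing
a summand in each column is choosing the next row of the triangle. -/
theorem triangleSum_eq_det (x : K) (M : ℕ → ℕ → K) (k : ℕ) (t : Fin k → ℕ) (ht : StrictMono t) :
    triangleSum x M k t = (Matrix.of fun a b : Fin k => triangleRow x M k a (t b)).det := by
  induction k with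
  | zero => simp [triangleSum]
  | succ k ih =>
    rw [det_triangleRow_succ x M k t ht, ← Matrix.det_transpose, triangleSum]
    have := (Matrix.detRowAlternating (R := K) (n := Fin k)).toMultilinearMap.map_sum_finset
      (fun (b : Fin k) (j : ℕ) => (fun a : Fin k =>
        interlaceWeight x (t b.castSucc) (t b.succ) j * (triangleRow x M k a j * (M k j)⁻¹)))
      (fun b => Icc (t b.castSucc) (t b.succ))
    have h2 : (Matrix.of fun a b : Fin k =>
        ∑ j ∈ Icc (t b.castSucc) (t b.succ), interlaceWeight x (t b.castSucc) (t b.succ) j *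
          (triangleRow x M k a j * (M k j)⁻¹)).transpose = Matrix.of fun b =>
        ∑ j ∈ Icc (t b.castSucc) (t b.succ), fun a : Fin k =>
        interlaceWeight x (t b.castSucc) (t b.succ) j * (triangleRow x M k a j * (M k j)⁻¹) := by
      ext i j
      simp [Finset.sum_apply]
    rw [h2]
    refine Eq.trans ?_ (congrArg (fun z => (∏ b, M k (t b)) * z) this.symm)
    rw [Finset.mul_sum, Finset.sum_filter]
    refine Finset.sum_congr rfl fun s hs => ?_
    rw [Fintype.mem_piFinset] at hs
    have h3 : (Matrix.detRowAlternating (R := K) (n := Fin k)).toMultilinearMap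
        (fun b a => interlaceWeight x (t b.castSucc) (t b.succ) (s b) *
          (triangleRow x M k a (s b) * (M k (s b))⁻¹)) =
        (∏ b, interlaceWeight x (t b.castSucc) (t b.succ) (s b) * (M k (s b))⁻¹) *
          (Matrix.of fun a b : Fin k => triangleRow x M k a (s b)).det := by
      rw [← Matrix.det_mul_row, ← Matrix.det_transpose]
      refine congrArg Matrix.det ?_
      ext i j
      simp only [Matrix.transpose_apply, Matrix.of_apply]
      ring
    rw [h3]
    split_ifs with hmono
    · rw [ih s hmono, Finset.prod_mul_distrib]
      ring
    -- An interlacing tuple is always weakly increasing, so a non-strict one repeats a value and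
    -- yields two equal columns. The strictness condition on triangles therefore costs nothing.
    · have hm : Monotone s := by
        rw [monotone_iff_forall_lt]
        intro i j hij
        refine (mem_Icc.1 (hs i)).2.trans (le_trans (ht.monotone ?_) (mem_Icc.1 (hs j)).1)
        exact hij
      have hni : ¬ Function.Injective s := fun h => hmono (hm.strictMono_of_injective h)
      rw [Function.Injective] at hni
      push Not at hni
      obtain ⟨i, j, hij, hne⟩ := hni
      rw [Matrix.det_zero_of_column_eq hne (fun a => by simp [hij])]
      simp

theorem sum_interlaceWeight_consecutive (x : K) (f : ℕ → K) (b : ℕ) :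
    ∑ j ∈ Icc b (b + 1), interlaceWeight x b (b + 1) j * f j = f b + x * f (b + 1) := by
  rw [← Finset.Ico_succ_right_eq_Icc, Nat.succ_eq_succ,
    Finset.sum_Ico_succ_top (Nat.le_succ b), Nat.Ico_succ_singleton, Finset.sum_singleton]
  simp [interlaceWeight]

/-- Over a consecutive bottom row each entry has only two possible values, with weights 1 and x, so
each column is a pair combination. Factoring out x puts it in the shape of `det_three_term` with y =
-x⁻¹. -/
theorem triangleSum_consecutive (x : K) (hx : x ≠ 0) (M : ℕ → ℕ → K) (k s : ℕ) :
    triangleSum x M (k + 1) (fun b => b + s) = (∏ b : Fin (k + 1), M k (b + s)) *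
      (x ^ k * (Matrix.of fun a b : Fin k =>
        triangleRow x M k a (b + s + 1) * (M k (b + s + 1))⁻¹ -
          (-x⁻¹) * (triangleRow x M k a (b + s) * (M k (b + s))⁻¹)).det) := by
  have hmono : StrictMono fun b : Fin (k + 1) => (b : ℕ) + s := fun a b h => by simpa using h
  rw [triangleSum_eq_det _ _ _ _ hmono, det_triangleRow_succ _ _ _ _ hmono]
  congr 1
  have := Matrix.det_mul_row (fun _ : Fin k => x) (Matrix.of fun a b : Fin k =>
        triangleRow x M k a (b + s + 1) * (M k (b + s + 1))⁻¹ -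
          (-x⁻¹) * (triangleRow x M k a (b + s) * (M k (b + s))⁻¹))
  rw [Finset.prod_const, Finset.card_univ, Fintype.card_fin] at this
  rw [← this]
  congr 1
  ext a b
  simp only [Matrix.of_apply, Fin.val_castSucc, Fin.val_succ, add_right_comm _ 1 s]
  rw [sum_interlaceWeight_consecutive x fun j => triangleRow x M k a j * (M k j)⁻¹]
  field_simp
  ring

/-- The free normalization `N` serves to give these determinants the same entries as those of
`triangleSum_consecutive`. -/
theorem triangleSum_eq_prod_mul_det (x : K) (M : ℕ → ℕ → K) (k : ℕ) (N : ℕ → K)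
    (hN : ∀ j, N j ≠ 0) (t : Fin k → ℕ) (ht : StrictMono t) :
    triangleSum x M k t = (∏ b, N (t b)) *
      (Matrix.of fun a b : Fin k => triangleRow x M k a (t b) * (N (t b))⁻¹).det := by
  rw [triangleSum_eq_det _ _ _ _ ht, ← Matrix.det_mul_row]
  congr 1
  ext a b
  simp only [Matrix.of_apply]
  rw [mul_comm, mul_assoc, inv_mul_cancel₀ (hN _), mul_one]

/-- Condensation of sums over monotone triangles. -/
theorem triangleSum_condensation (x : K) (hx : x ≠ 0) (M : ℕ → ℕ → K) (hM : ∀ i j, M i j ≠ 0)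
    (m : ℕ) :
    triangleSum x M (m + 2) (fun b => b) *
        triangleSum x (fun i => M (i + 1)) m (fun b => b + 1) =
      triangleSum x M (m + 1) (fun b => b) *
          triangleSum x (fun i => M (i + 1)) (m + 1) (fun b => b + 1) +
        x * (triangleSum x M (m + 1) (fun b => b + 1) *
          triangleSum x (fun i => M (i + 1)) (m + 1) (fun b => b)) := by
  have hmono (k s : ℕ) : StrictMono fun b : Fin k => (b : ℕ) + s := fun a b h => by simpa using h
  -- Each product pairs one sum of larger size, opened by one summation into paired columns, with
  -- one left as a plain minor; all use the array of level `m + 1` divided by `M (m + 1)`.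
  have e1 := triangleSum_consecutive x hx M (m + 1) 0
  have e2 := triangleSum_eq_prod_mul_det x (fun i => M (i + 1)) m (M (m + 1)) (hM _) _ (hmono m 1)
  have e3 := triangleSum_eq_prod_mul_det x M (m + 1) (M (m + 1)) (hM _) _ (hmono (m + 1) 0)
  have e4 := triangleSum_consecutive x hx (fun i => M (i + 1)) m 1
  have e5 := triangleSum_eq_prod_mul_det x M (m + 1) (M (m + 1)) (hM _) _ (hmono (m + 1) 1)
  have e6 := triangleSum_consecutive x hx (fun i => M (i + 1)) m 0
  simp only [add_zero, triangleRow_shift x M (Fin.is_lt _)] at e1 e2 e3 e4 e5 e6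
  rw [e1, e2, e3, e4, e5, e6]
  have key := det_three_term (fun a j => triangleRow x M (m + 1) a j * (M (m + 1) j)⁻¹) (-x⁻¹) m
  simp only [add_assoc, Nat.reduceAdd] at key ⊢
  rw [Fin.prod_univ_succ (fun b : Fin (m + 1 + 1) => M (m + 1) b),
    Fin.prod_univ_castSucc (fun b : Fin (m + 1) => M (m + 1) (b + 1)),
    Fin.prod_univ_succ (fun b : Fin (m + 1) => M (m + 1) b)]
  simp only [Fin.val_succ, Fin.val_castSucc, Fin.val_zero, Fin.val_last]
  rw [Fin.prod_univ_castSucc (fun b : Fin (m + 1) => M (m + 1) (b + 1))]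
  simp only [Fin.val_castSucc, Fin.val_last]
  generalize (∏ b : Fin m, M (m + 1) (b + 1)) = P
  generalize M (m + 1) 0 = p
  generalize M (m + 1) (m + 1) = q
  have hx' : x * x⁻¹ = 1 := mul_inv_cancel₀ hx
  have aux : ∀ y D1 D2 D3 D4 D5 D6 : K, x * y = 1 → D1 * D2 = D3 * D4 - -y * (D5 * D6) →
      p * (P * q) * (x ^ (m + 1) * D1) * (P * D2) =
        p * P * D5 * (P * q * (x ^ m * D6)) + x * (P * q * D3 * (p * P * (x ^ m * D4))) := by
    intro y D1 D2 D3 D4 D5 D6 hy h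
    linear_combination p * q * P ^ 2 * x ^ (m + 1) * h + p * q * P ^ 2 * x ^ m * D5 * D6 * hy
  exact aux _ _ _ _ _ _ _ hx' key

/-- Invariance under a translation of the columns. -/
theorem triangleSum_translate (x : K) (M : ℕ → ℕ → K) (k : ℕ) (t : Fin k → ℕ) :
    triangleSum x (fun i j => M i (j + 1)) k t = triangleSum x M k (fun b => t b + 1) := by
  induction k with
  | zero => rfl
  | succ k ih =>
    rw [triangleSum, triangleSum]
    refine Finset.sum_nbij' (fun s b => s b + 1) (fun s b => s b - 1) ?_ ?_ ?_ ?_ ?_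
    · intro s hs
      simp only [mem_filter, Fintype.mem_piFinset, mem_Icc] at hs ⊢
      exact ⟨fun b => by have := hs.1 b; omega, fun a b h => by have := hs.2 h; simpa using this⟩
    · intro s hs
      simp only [mem_filter, Fintype.mem_piFinset, mem_Icc] at hs ⊢
      refine ⟨fun b => by have := hs.1 b; omega, fun a b h => ?_⟩
      have h1 := hs.2 h
      have h2 := hs.1 a
      have h3 := hs.1 b
      show s a - 1 < s b - 1
      omega
    · intro s _
      simp
    · intro s hs
      simp only [mem_filter, Fintype.mem_piFinset, mem_Icc] at hs
      funext b
      have := hs.1 b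
      show s b - 1 + 1 = s b
      omega
    · intro s _
      rw [ih]
      simp [interlaceWeight]

/-! ### Alternation in terms of prefix sums -/

/-- The sum of the first `i` entries of `v`. -/
def prefixSum {n : ℕ} (v : Fin n → ℤ) (i : ℕ) : ℤ := ∑ j : Fin n, if (j : ℕ) < i then v j else 0

theorem prefixSum_zero {n : ℕ} (v : Fin n → ℤ) : prefixSum v 0 = 0 := by simp [prefixSum]

theorem prefixSum_of_le {n : ℕ} (v : Fin n → ℤ) {i : ℕ} (h : n ≤ i) :
    prefixSum v i = ∑ j, v j :=
  Finset.sum_congr rfl fun j _ => if_pos (j.is_lt.trans_le h)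

theorem prefixSum_succ {n : ℕ} (v : Fin n → ℤ) (i : Fin n) :
    prefixSum v (i + 1) = prefixSum v i + v i := by
  have : v i = ∑ j : Fin n, if j = i then v j else 0 := by simp
  rw [this, prefixSum, prefixSum, ← Finset.sum_add_distrib]
  refine Finset.sum_congr rfl fun j _ => ?_
  by_cases h : j = i
  · subst h; simp
  · have : (j : ℕ) ≠ i := fun h' => h (Fin.ext h')
    simp only [h, if_false, add_zero]
    congr 1
    exact propext (by omega)

/-- All prefix sums of `v` are `0` or `1`. -/
def ZeroOnePrefixes {n : ℕ} (v : Fin n → ℤ) : Prop :=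
  ∀ i, prefixSum v i = 0 ∨ prefixSum v i = 1

theorem ZeroOnePrefixes.entry {n : ℕ} {v : Fin n → ℤ} (h : ZeroOnePrefixes v) (i : Fin n) :
    v i = 0 ∨ v i = 1 ∨ v i = -1 := by
  have := prefixSum_succ v i
  have h1 := h i
  have h2 := h (i + 1)
  omega

/-- The prefix sum is constant between two consecutive nonzero entries; being confined to 0 and 1,
it must undo its last step. -/
theorem ZeroOnePrefixes.alternatesToOne {n : ℕ} {v : Fin n → ℤ} (h : ZeroOnePrefixes v)
    (hs : ∑ j, v j = 1) : AlternatesToOne v := by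
  refine ⟨fun j k hjk hj hk hz => ?_, hs⟩
  have key : ∀ l : ℕ, (j : ℕ) + 1 ≤ l → l ≤ k → prefixSum v l = prefixSum v (j + 1) := by
    intro l hl
    induction l, hl using Nat.le_induction with
    | base => intro _; rfl
    | succ l hl ih =>
      intro hlk
      have hln : l < n := by omega
      have := prefixSum_succ v ⟨l, hln⟩
      rw [hz ⟨l, hln⟩ (by rw [Fin.lt_def]; simp; omega) (by rw [Fin.lt_def]; simp; omega),
        add_zero] at this
      rw [← ih (by omega)]
      exact this
  have h1 := key k (by rw [Fin.lt_def] at hjk; omega) le_rfl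
  have h2 := prefixSum_succ v j
  have h3 := prefixSum_succ v k
  have h4 := h j
  have h5 := h (j + 1)
  have h6 := h (k + 1)
  omega

theorem AlternatesToOne.zeroOnePrefixes {n : ℕ} {v : Fin n → ℤ} (h : AlternatesToOne v)
    (he : ∀ i, v i = 0 ∨ v i = 1 ∨ v i = -1) : ZeroOnePrefixes v := by
  obtain ⟨halt, hs⟩ := h
  -- Here `e` is the first nonzero entry. By alternation, twice a prefix sum is the first plus the
  -- latest nonzero entry; total sum 1 then forces `e = 1`.
  have key : ∃ e : ℤ, (e = 1 ∨ e = -1) ∧ ∀ i : ℕ, i ≤ n →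
      ((∀ j : Fin n, (j : ℕ) < i → v j = 0) ∧ prefixSum v i = 0) ∨
      ∃ j : Fin n, (j : ℕ) < i ∧ v j ≠ 0 ∧ (∀ l : Fin n, j < l → (l : ℕ) < i → v l = 0) ∧
        2 * prefixSum v i = e + v j := by
    by_cases hz : ∀ j, v j = 0
    · exact ⟨1, Or.inl rfl, fun i _ => Or.inl ⟨fun j _ => hz j, by simp [prefixSum, hz]⟩⟩
    · push Not at hz
      obtain ⟨j₀, hj₀, hmin⟩ : ∃ j₀ : Fin n, v j₀ ≠ 0 ∧ ∀ l < j₀, v l = 0 := by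
        obtain ⟨j, hj, hm⟩ := WellFounded.has_min (wellFounded_lt (α := Fin n)) {j | v j ≠ 0} hz
        exact ⟨j, hj, fun l hl => by by_contra h0; exact hm l h0 hl⟩
      refine ⟨v j₀, by have := he j₀; omega, fun i => ?_⟩
      induction i with
      | zero => exact fun _ => Or.inl ⟨fun j h => absurd h (Nat.not_lt_zero _), prefixSum_zero v⟩
      | succ i ih =>
        intro hi
        have hstep := prefixSum_succ v ⟨i, hi⟩
        simp only at hstep
        have hlast (j : Fin n) (h1 : (j : ℕ) < i + 1) (h2 : ¬ (j : ℕ) < i) : j = ⟨i, hi⟩ :=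
          Fin.ext (by simp; omega)
        rcases ih (by omega) with ⟨hall, hp⟩ | ⟨j, hji, hj, hjl, hp⟩
        · by_cases hv : v ⟨i, hi⟩ = 0
          · refine Or.inl ⟨fun j hj => ?_, by rw [hstep, hp, hv, add_zero]⟩
            by_cases h2 : (j : ℕ) < i
            · exact hall j h2
            · rw [hlast j hj h2, hv]
          · refine Or.inr ⟨⟨i, hi⟩, Nat.lt_succ_self i, hv, fun l h1 h2 => ?_, ?_⟩
            · rw [Fin.lt_def] at h1; simp at h1; omega
            · have : j₀ = ⟨i, hi⟩ := by
                refine le_antisymm ?_ ?_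
                · by_contra hlt
                  exact hv (hmin _ (not_le.1 hlt))
                · rw [Fin.le_def]
                  by_contra hlt
                  exact hj₀ (hall _ (not_le.1 hlt))
              rw [this, hstep, hp]; ring
        · by_cases hv : v ⟨i, hi⟩ = 0
          · refine Or.inr ⟨j, by omega, hj, fun l h1 h2 => ?_, by rw [hstep, hv, add_zero, hp]⟩
            by_cases h3 : (l : ℕ) < i
            · exact hjl l h1 h3
            · rw [hlast l h2 h3, hv]
          · refine Or.inr ⟨⟨i, hi⟩, Nat.lt_succ_self i, hv, fun l h1 h2 => ?_, ?_⟩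
            · rw [Fin.lt_def] at h1; simp at h1; omega
            · have := halt j ⟨i, hi⟩ hji hj hv fun l h1 h2 => hjl l h1 h2
              rw [hstep]; omega
  obtain ⟨e, he1, hkey⟩ := key
  have htop : e = 1 := by
    have hn := prefixSum_of_le v le_rfl
    rcases hkey n le_rfl with ⟨_, hp⟩ | ⟨j, _, _, _, hp⟩
    · omega
    · have := he j; omega
  intro i
  rcases le_total i n with hi | hi
  · rcases hkey i hi with ⟨_, hp⟩ | ⟨j, _, _, _, hp⟩
    · exact Or.inl hp
    · have := he j; omega
  · exact Or.inr ((prefixSum_of_le v hi).trans hs)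

theorem isASM_iff {n : ℕ} (A : Fin n → Fin n → ℤ) :
    IsASM A ↔ (∀ i, ZeroOnePrefixes (A i) ∧ ∑ j, A i j = 1) ∧
      ∀ j, ZeroOnePrefixes (fun i => A i j) ∧ ∑ i, A i j = 1 := by
  constructor
  · rintro ⟨he, hr, hc⟩
    exact ⟨fun i => ⟨(hr i).zeroOnePrefixes fun j => he i j, (hr i).2⟩,
      fun j => ⟨(hc j).zeroOnePrefixes fun i => he i j, (hc j).2⟩⟩
  · rintro ⟨hr, hc⟩
    exact ⟨fun i j => (hr i).1.entry j, fun i => (hr i).1.alternatesToOne (hr i).2,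
      fun j => (hc j).1.alternatesToOne (hc j).2⟩

/-! ### Interlacing tuples and the weight of a row -/

/-- The number of entries of `t` below `i`. -/
def countBelow {k : ℕ} (t : Fin k → ℕ) (i : ℕ) : ℕ := #{b | t b < i}

/-- By strict monotonicity, the indices of entries below `i` form an initial segment. -/
theorem lt_countBelow_iff {k : ℕ} {t : Fin k → ℕ} (ht : StrictMono t) (b : Fin k) (i : ℕ) :
    (b : ℕ) < countBelow t i ↔ t b < i := by
  constructor
  · intro h
    by_contra hb
    have : ({c | t c < i} : Finset (Fin k)) ⊆ Finset.Iio b := fun c hc => by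
      rw [Finset.mem_filter] at hc
      exact Finset.mem_Iio.2 (ht.lt_iff_lt.1 (hc.2.trans_le (not_lt.1 hb)))
    have := Finset.card_le_card this
    rw [Fin.card_Iio] at this
    exact absurd h (not_lt.2 this)
  · intro h
    have : Finset.Iic b ⊆ ({c | t c < i} : Finset (Fin k)) := fun c hc => by
      rw [Finset.mem_filter]
      exact ⟨Finset.mem_univ _, (ht.monotone (Finset.mem_Iic.1 hc)).trans_lt h⟩
    have := Finset.card_le_card this
    rw [Fin.card_Iic] at this
    exact this

theorem countBelow_le {k : ℕ} (t : Fin k → ℕ) (i : ℕ) : countBelow t i ≤ k :=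
  (Finset.card_le_univ _).trans_eq (Fintype.card_fin k)

/-- Interlacing in terms of counting functions. -/
theorem interlace_iff_countBelow {k : ℕ} {t : Fin k → ℕ} {t' : Fin (k + 1) → ℕ}
    (ht : StrictMono t) (ht' : StrictMono t') :
    (∀ b, t' b.castSucc ≤ t b ∧ t b ≤ t' b.succ) ↔
      ∀ i, countBelow t i ≤ countBelow t' i ∧ countBelow t' i ≤ countBelow t i + 1 := by
  constructor
  · intro h i
    constructor
    · by_contra hlt
      rw [not_le] at hlt
      have hk : countBelow t' i < k := hlt.trans_le (countBelow_le t i)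
      have h1 := (lt_countBelow_iff ht ⟨_, hk⟩ i).1 hlt
      have h2 := (lt_countBelow_iff ht' (Fin.castSucc ⟨_, hk⟩) i).2 ((h _).1.trans_lt h1)
      simp at h2
    · by_contra hlt
      rw [not_le] at hlt
      have hk : countBelow t i < k := by have := countBelow_le t' i; omega
      have h1 := (lt_countBelow_iff ht' (Fin.succ ⟨_, hk⟩) i).1 (by simpa using hlt)
      have h2 := (lt_countBelow_iff ht ⟨_, hk⟩ i).2 ((h _).2.trans_lt h1)
      simp at h2
  · intro h b
    constructor
    · have h1 := (lt_countBelow_iff ht b (t b + 1)).2 (Nat.lt_succ_self _)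
      have h2 := (lt_countBelow_iff ht' b.castSucc (t b + 1)).1 (h1.trans_le (h _).1)
      omega
    · have h1 := (lt_countBelow_iff ht' b.succ (t' b.succ + 1)).2 (Nat.lt_succ_self _)
      have h2 := (lt_countBelow_iff ht b (t' b.succ + 1)).1
        (by have := (h (t' b.succ + 1)).2; simp at h1; omega)
      omega

/-- The indicator of the range of `t`. -/
def tupleIndicator {k : ℕ} (t : Fin k → ℕ) (j : ℕ) : ℤ := ∑ b, if t b = j then 1 else 0

theorem tupleIndicator_eq {k : ℕ} {t : Fin k → ℕ} (ht : Function.Injective t) (j : ℕ) :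
    tupleIndicator t j = if j ∈ Set.range t then 1 else 0 := by
  classical
  split_ifs with h
  · obtain ⟨b, rfl⟩ := h
    simp [tupleIndicator, ht.eq_iff]
  · exact Finset.sum_eq_zero fun b _ => if_neg fun hb => h ⟨b, hb⟩

theorem sum_mul_tupleIndicator {k m : ℕ} {t : Fin k → ℕ} (hm : ∀ b, t b < m) (f : ℕ → ℤ) :
    ∑ j : Fin m, f j * tupleIndicator t j = ∑ b, f (t b) := by
  simp only [tupleIndicator, Finset.mul_sum]
  rw [Finset.sum_comm]
  refine Finset.sum_congr rfl fun b _ => ?_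
  rw [Finset.sum_eq_single ⟨t b, hm b⟩]
  · simp
  · intro j _ hj
    rw [if_neg fun h => hj (Fin.ext h.symm), mul_zero]
  · simp

theorem prefixSum_tupleIndicator {k m : ℕ} {t : Fin k → ℕ} (hm : ∀ b, t b < m) (i : ℕ) :
    prefixSum (fun j : Fin m => tupleIndicator t j) i = countBelow t i := by
  have := sum_mul_tupleIndicator hm fun j => if j < i then 1 else 0
  simp only [ite_mul, one_mul, zero_mul] at this
  rw [prefixSum, this, countBelow]
  simp

theorem sum_tupleIndicator {k m : ℕ} {t : Fin k → ℕ} (hm : ∀ b, t b < m) :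
    ∑ j : Fin m, tupleIndicator t j = k := by
  have := sum_mul_tupleIndicator hm fun _ => 1
  simpa using this

theorem prefixSum_sub {n : ℕ} (v w : Fin n → ℤ) (i : ℕ) :
    prefixSum (fun j => v j - w j) i = prefixSum v i - prefixSum w i := by
  rw [prefixSum, prefixSum, prefixSum, ← Finset.sum_sub_distrib]
  exact Finset.sum_congr rfl fun j _ => by split_ifs <;> simp

/-- The prefix sums of a difference of indicators are differences of counting functions, and
interlacing says that these stay in {0, 1}. This is the link between rows of the matrix and levels
of a monotone triangle. -/
theorem zeroOnePrefixes_sub_tupleIndicator {k m : ℕ} {t : Fin k → ℕ} {t' : Fin (k + 1) → ℕ}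
    (ht : StrictMono t) (ht' : StrictMono t') (hm : ∀ b, t b < m) (hm' : ∀ b, t' b < m) :
    ZeroOnePrefixes (fun j : Fin m => tupleIndicator t' j - tupleIndicator t j) ↔
      ∀ b, t' b.castSucc ≤ t b ∧ t b ≤ t' b.succ := by
  rw [interlace_iff_countBelow ht ht']
  refine forall_congr' fun i => ?_
  rw [prefixSum_sub, prefixSum_tupleIndicator hm, prefixSum_tupleIndicator hm']
  omega

/-- A `0`-`1` vector is the indicator of a strictly increasing tuple. -/
theorem exists_tupleIndicator_eq {k m : ℕ} (s : Fin m → ℤ) (hs : ∀ j, s j = 0 ∨ s j = 1)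
    (hk : ∑ j, s j = k) :
    ∃ t : Fin k → ℕ, StrictMono t ∧ (∀ b, t b < m) ∧ ∀ j : Fin m, s j = tupleIndicator t j := by
  have hcard : #({j | s j = 1} : Finset (Fin m)) = k := by
    have : ∑ j, s j = ∑ j, if s j = 1 then 1 else 0 :=
      Finset.sum_congr rfl fun j _ => by rcases hs j with h | h <;> simp [h]
    rw [this, Finset.sum_boole] at hk
    exact_mod_cast hk
  refine ⟨fun b => (Finset.orderEmbOfFin _ hcard b : Fin m), fun a b h => ?_, fun b => Fin.is_lt _,
    fun j => ?_⟩
  · simpa using h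
  · rw [tupleIndicator_eq]
    · have hr := Finset.range_orderEmbOfFin _ hcard
      have : (j : ℕ) ∈ Set.range (fun b => ((Finset.orderEmbOfFin _ hcard b : Fin m) : ℕ)) ↔
          s j = 1 := by
        have h2 : j ∈ Set.range (Finset.orderEmbOfFin _ hcard) ↔ s j = 1 := by
          rw [hr]; simp
        rw [← h2]
        simp only [Set.mem_range, Fin.ext_iff]
      rcases hs j with h | h
      · rw [if_neg (by rw [this]; omega), h]
      · rw [if_pos (this.2 h), h]
    · intro a b h
      simpa [Fin.val_inj] using h

theorem tuple_eq_of_tupleIndicator_eq {k m : ℕ} {s t : Fin k → ℕ} (hs : StrictMono s)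
    (ht : StrictMono t) (hsm : ∀ b, s b < m) (htm : ∀ b, t b < m)
    (h : ∀ j : Fin m, tupleIndicator s j = tupleIndicator t j) : s = t := by
  classical
  refine (StrictMono.range_inj hs ht).1 ?_
  ext j
  by_cases hj : j < m
  · have := h ⟨j, hj⟩
    simp only [tupleIndicator_eq hs.injective, tupleIndicator_eq ht.injective] at this
    split_ifs at this <;> simp_all
  · exact iff_of_false (fun ⟨b, hb⟩ => hj (hb ▸ hsm b)) fun ⟨b, hb⟩ => hj (hb ▸ htm b)

theorem zpow_sum_eq_prod {ι : Type*} {x : K} (hx : x ≠ 0) (s : Finset ι) (f : ι → ℤ) :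
    x ^ (∑ b ∈ s, f b) = ∏ b ∈ s, x ^ f b := by
  classical
  induction s using Finset.induction_on with
  | empty => simp
  | insert a s ha ih => rw [Finset.sum_insert ha, Finset.prod_insert ha, zpow_add₀ hx, ih]

theorem prod_zpow_tupleIndicator {k m : ℕ} {t : Fin k → ℕ} (hm : ∀ b, t b < m) (N : ℕ → K)
    (hN : ∀ j, N j ≠ 0) :
    ∏ j : Fin m, N j ^ tupleIndicator t j = ∏ b, N (t b) := by
  have h (j : Fin m) : N j ^ tupleIndicator t j = ∏ b, N j ^ (if t b = j then 1 else 0 : ℤ) :=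
    zpow_sum_eq_prod (hN j) _ _
  simp only [h]
  rw [Finset.prod_comm]
  refine Finset.prod_congr rfl fun b _ => ?_
  rw [Finset.prod_eq_single ⟨t b, hm b⟩]
  · simp
  · intro j _ hj
    rw [if_neg fun h => hj (Fin.ext h.symm), zpow_zero]
  · simp

theorem countBelow_self {k : ℕ} {t : Fin k → ℕ} (ht : StrictMono t) (b : Fin k) :
    countBelow t (t b + 1) = b + 1 := by
  have h1 := (lt_countBelow_iff ht b (t b + 1)).2 (Nat.lt_succ_self _)
  by_contra hne
  have h2 : (b : ℕ) + 1 < countBelow t (t b + 1) := by omega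
  have hk := h2.trans_le (countBelow_le _ _)
  have h3 := (lt_countBelow_iff ht ⟨_, hk⟩ (t b + 1)).1 h2
  have h4 : t b < t ⟨b + 1, hk⟩ := ht (by rw [Fin.lt_def]; simp)
  omega

theorem countBelow_interlace {k : ℕ} {t : Fin k → ℕ} {t' : Fin (k + 1) → ℕ}
    (ht : StrictMono t) (ht' : StrictMono t')
    (h : ∀ b, t' b.castSucc ≤ t b ∧ t b ≤ t' b.succ) (b : Fin k) :
    (countBelow t' (t b + 1) : ℤ) - countBelow t (t b + 1) = if t b = t' b.succ then 1 else 0 := by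
  have h1 := (interlace_iff_countBelow ht ht').1 h (t b + 1)
  have h2 := countBelow_self ht b
  have h3 := lt_countBelow_iff ht' b.succ (t b + 1)
  have h4 := (h b).2
  rw [Fin.val_succ] at h3
  split_ifs with heq
  · have := h3.2 (by omega)
    omega
  · have : ¬ (b : ℕ) + 1 < countBelow t' (t b + 1) := fun hlt => by
      have := h3.1 hlt
      omega
    omega

/-- No entry of `t'` lies strictly between its neighbours `t' b.castSucc` and `t' b.succ`. -/
theorem tupleIndicator_interlace {k : ℕ} {t : Fin k → ℕ} {t' : Fin (k + 1) → ℕ}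
    (ht' : StrictMono t') (h : ∀ b, t' b.castSucc ≤ t b ∧ t b ≤ t' b.succ) (b : Fin k) :
    tupleIndicator t' (t b) = if t b = t' b.castSucc ∨ t b = t' b.succ then 1 else 0 := by
  classical
  rw [tupleIndicator_eq ht'.injective]
  congr 1
  refine propext ⟨?_, ?_⟩
  · rintro ⟨c, hc⟩
    rcases lt_or_ge b.castSucc c with hlt | hle
    · exact Or.inr (le_antisymm (h b).2 (hc ▸ ht'.monotone (Fin.castSucc_lt_iff_succ_le.1 hlt)))
    · exact Or.inl (le_antisymm (hc ▸ ht'.monotone hle) (h b).1)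
  · rintro (h | h)
    · exact ⟨_, h.symm⟩
    · exact ⟨_, h.symm⟩

/-- The weight of a row of an alternating sign matrix, given by the positions of the ones in the
column sums above and below it. -/
theorem row_weight_eq {k m : ℕ} {x : K} (hx : x ≠ 0) (N : ℕ → K) (hN : ∀ j, N j ≠ 0)
    {t : Fin k → ℕ} {t' : Fin (k + 1) → ℕ} (ht : StrictMono t) (ht' : StrictMono t')
    (hm : ∀ b, t b < m) (hm' : ∀ b, t' b < m)
    (h : ∀ b, t' b.castSucc ≤ t b ∧ t b ≤ t' b.succ) (v : Fin m → ℤ)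
    (hv : v = fun j : Fin m => tupleIndicator t' j - tupleIndicator t j) :
    x ^ (∑ j : Fin m, tupleIndicator t j * prefixSum v (j + 1)) *
        (1 + x) ^ #{j | v j = -1} * ∏ j : Fin m, N j ^ v j =
      (∏ b, interlaceWeight x (t' b.castSucc) (t' b.succ) (t b)) *
        ((∏ b, N (t' b)) * ∏ b, (N (t b))⁻¹) := by
  -- New inversions are counted by the entries of `t` that touch their right neighbour below, whence
  -- the weight x.
  have e1 : ∑ j : Fin m, tupleIndicator t j * prefixSum v (j + 1) =
      ∑ b, if t b = t' b.succ then 1 else 0 := by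
    have := sum_mul_tupleIndicator hm fun j => (countBelow t' (j + 1) : ℤ) - countBelow t (j + 1)
    simp only [countBelow_interlace ht ht' h] at this
    rw [← this]
    refine Finset.sum_congr rfl fun j _ => ?_
    rw [hv, prefixSum_sub, prefixSum_tupleIndicator hm, prefixSum_tupleIndicator hm', mul_comm]
  -- An entry -1 sits where `t` has an element and `t'` has none, that is, strictly between the two
  -- neighbours; hence the weight 1+x.
  have e2 : #{j | v j = -1} = ∑ b, if t b = t' b.castSucc ∨ t b = t' b.succ then 0 else 1 := by
    have h1 := sum_mul_tupleIndicator hm fun j => 1 - tupleIndicator t' j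
    simp only [tupleIndicator_interlace ht' h] at h1
    have h2 : (#{j | v j = -1} : ℤ) =
        ∑ j : Fin m, (1 - tupleIndicator t' j) * tupleIndicator t j := by
      rw [Finset.card_filter, Nat.cast_sum]
      refine Finset.sum_congr rfl fun j _ => ?_
      classical
      simp only [hv, tupleIndicator_eq ht.injective, tupleIndicator_eq ht'.injective]
      split_ifs <;> simp_all
    have h3 : (#{j | v j = -1} : ℤ) =
        ((∑ b, if t b = t' b.castSucc ∨ t b = t' b.succ then 0 else 1 : ℕ) : ℤ) := by
      rw [h2, h1, Nat.cast_sum]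
      refine Finset.sum_congr rfl fun b _ => ?_
      split_ifs <;> simp
    exact_mod_cast h3
  have e3 : ∏ j : Fin m, N j ^ v j = (∏ b, N (t' b)) * ∏ b, (N (t b))⁻¹ := by
    rw [Finset.prod_inv_distrib, ← prod_zpow_tupleIndicator hm N hN,
      ← prod_zpow_tupleIndicator hm' N hN, ← div_eq_mul_inv, ← Finset.prod_div_distrib]
    refine Finset.prod_congr rfl fun j _ => ?_
    rw [hv, zpow_sub₀ (hN j)]
  rw [e1, e2, e3, zpow_sum_eq_prod hx, ← Finset.prod_pow_eq_pow_sum, ← Finset.prod_mul_distrib]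
  congr 1
  refine Finset.prod_congr rfl fun b _ => ?_
  have hlt : t' b.castSucc < t' b.succ := ht' b.castSucc_lt_succ
  rw [interlaceWeight]
  by_cases h1 : t b = t' b.castSucc
  · rw [if_pos h1, if_neg (by omega), if_pos (Or.inl h1)]; simp
  · by_cases h2 : t b = t' b.succ
    · rw [if_neg h1, if_pos h2, if_pos h2, if_pos (Or.inr h2)]; simp
    · rw [if_neg h1, if_neg h2, if_neg h2, if_neg (by tauto)]; simp

/-! ### From alternating sign matrices to monotone triangles -/

/-- The arrays formed by the first `k` rows of alternating sign matrices with `m` columns, with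
column sums the indicator of `t`. -/
noncomputable def partialASM (k m : ℕ) (t : Fin k → ℕ) : Finset (Fin k → Fin m → ℤ) :=
  @Finset.filter _ (fun A => (∀ i, ZeroOnePrefixes (A i) ∧ ∑ j, A i j = 1) ∧
      ∀ j, ZeroOnePrefixes (fun i => A i j) ∧ ∑ i, A i j = tupleIndicator t j) (Classical.decPred _)
    (Fintype.piFinset fun _ : Fin k => Fintype.piFinset fun _ : Fin m => ({0, 1, -1} : Finset ℤ))

theorem mem_partialASM {k m : ℕ} {t : Fin k → ℕ} {A : Fin k → Fin m → ℤ} :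
    A ∈ partialASM k m t ↔ (∀ i, ZeroOnePrefixes (A i) ∧ ∑ j, A i j = 1) ∧
      ∀ j, ZeroOnePrefixes (fun i => A i j) ∧ ∑ i, A i j = tupleIndicator t j := by
  refine (@Finset.mem_filter _ _ (Classical.decPred _) _ _).trans ?_
  rw [and_iff_right_iff_imp]
  intro h
  simp only [Fintype.mem_piFinset, Finset.mem_insert, Finset.mem_singleton]
  exact fun i j => (h.1 i).1.entry j

theorem prefixSum_snoc {k : ℕ} (v : Fin k → ℤ) (a : ℤ) (i : ℕ) :
    prefixSum (Fin.snoc (α := fun _ => ℤ) v a : Fin (k + 1) → ℤ) i =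
      prefixSum v i + if k < i then a else 0 := by
  rw [prefixSum, Fin.sum_univ_castSucc]
  simp [prefixSum]

theorem zeroOnePrefixes_snoc {k : ℕ} (v : Fin k → ℤ) (a : ℤ) :
    ZeroOnePrefixes (Fin.snoc (α := fun _ => ℤ) v a : Fin (k + 1) → ℤ) ↔
      ZeroOnePrefixes v ∧ (∑ i, v i + a = 0 ∨ ∑ i, v i + a = 1) := by
  constructor
  · intro h
    constructor
    · intro i
      rcases le_or_gt i k with hi | hi
      · have := h i
        rwa [prefixSum_snoc, if_neg (by omega), add_zero] at this
      · have := h k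
        rwa [prefixSum_snoc, if_neg (by omega), add_zero, prefixSum_of_le v le_rfl,
          ← prefixSum_of_le v hi.le] at this
    · have := h (k + 1)
      rwa [prefixSum_snoc, if_pos (by omega), prefixSum_of_le v (Nat.le_succ k)] at this
  · rintro ⟨h, hs⟩ i
    rw [prefixSum_snoc]
    split_ifs with hi
    · rwa [prefixSum_of_le v hi.le]
    · rw [add_zero]; exact h i

theorem snoc_apply_column {k m : ℕ} (A : Fin k → Fin m → ℤ) (v : Fin m → ℤ) (j : Fin m) :
    (fun i => (Fin.snoc (α := fun _ => Fin m → ℤ) A v : Fin (k + 1) → Fin m → ℤ) i j) =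
      Fin.snoc (α := fun _ => ℤ) (fun i => A i j) (v j) := by
  funext i
  refine Fin.lastCases ?_ (fun i => ?_) i <;> simp

/-- Deleting the last row is a bijection: the row is recovered as the difference of the column-sum
indicators below and above it, and it is admissible exactly when the two tuples interlace. -/
theorem sum_partialASM_succ {k m : ℕ} {t' : Fin (k + 1) → ℕ} (ht' : StrictMono t')
    (hm' : ∀ b, t' b < m) (f : (Fin (k + 1) → Fin m → ℤ) → K) :
    ∑ A ∈ partialASM (k + 1) m t', f A =
      ∑ t ∈ Fintype.piFinset (fun b : Fin k => Icc (t' b.castSucc) (t' b.succ)) with StrictMono t,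
        ∑ A ∈ partialASM k m t,
          f (Fin.snoc (α := fun _ => Fin m → ℤ) A
            fun j : Fin m => tupleIndicator t' j - tupleIndicator t j) := by
  rw [Finset.sum_sigma']
  symm
  have hlt {t : Fin k → ℕ} (h : ∀ b, t b ∈ Icc (t' b.castSucc) (t' b.succ)) (b : Fin k) :
      t b < m := (mem_Icc.1 (h b)).2.trans_lt (hm' _)
  refine Finset.sum_bij (fun p _ => Fin.snoc (α := fun _ => Fin m → ℤ) p.2
            fun j : Fin m => tupleIndicator t' j - tupleIndicator p.1 j) ?_ ?_ ?_ ?_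
  · rintro ⟨t, A⟩ hp
    simp only [Finset.mem_sigma, Finset.mem_filter, Fintype.mem_piFinset, mem_partialASM] at hp ⊢
    obtain ⟨⟨ht, hmono⟩, hr, hc⟩ := hp
    refine ⟨fun i => ?_, fun j => ?_⟩
    · refine Fin.lastCases ?_ (fun i => ?_) i
      · simp only [Fin.snoc_last]
        refine ⟨(zeroOnePrefixes_sub_tupleIndicator hmono ht' (hlt ht) hm').2
          fun b => mem_Icc.1 (ht b), ?_⟩
        rw [Finset.sum_sub_distrib, sum_tupleIndicator hm', sum_tupleIndicator (hlt ht)]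
        push_cast; ring
      · simpa only [Fin.snoc_castSucc] using hr i
    · constructor
      · rw [snoc_apply_column, zeroOnePrefixes_snoc, (hc j).2]
        refine ⟨(hc j).1, ?_⟩
        classical
        rw [add_sub_cancel, tupleIndicator_eq ht'.injective]
        split_ifs <;> simp
      · rw [Fin.sum_univ_castSucc]
        simp [(hc j).2]
  · rintro ⟨t, A⟩ hp ⟨s, B⟩ hq h
    simp only [Finset.mem_sigma, Finset.mem_filter, Fintype.mem_piFinset, mem_partialASM] at hp hq
    obtain ⟨hAB, hv⟩ := Fin.snoc_injective2 h
    have hts : t = s := by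
      refine tuple_eq_of_tupleIndicator_eq hp.1.2 hq.1.2 (hlt hp.1.1) (hlt hq.1.1) fun j => ?_
      have := congrFun hv j
      simpa using this
    simp only at hAB
    subst hts hAB
    rfl
  · intro B hB
    rw [mem_partialASM] at hB
    obtain ⟨hr, hc⟩ := hB
    set A : Fin k → Fin m → ℤ := Fin.init B with hA
    have hBA : B = Fin.snoc (α := fun _ => Fin m → ℤ) A (B (Fin.last k)) :=
      (Fin.snoc_init_self B).symm
    have hrA (i : Fin k) : ZeroOnePrefixes (A i) ∧ ∑ j, A i j = 1 := hr i.castSucc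
    have hcA (j : Fin m) : ZeroOnePrefixes (fun i => A i j) := by
      have := (hc j).1
      rw [hBA, snoc_apply_column, zeroOnePrefixes_snoc] at this
      exact this.1
    -- Column sums of the truncated array are prefix sums of the columns, hence 0 or 1, and they
    -- total `k`, since each of the `k` rows sums to 1.
    obtain ⟨t, hmono, htm, hAt⟩ := exists_tupleIndicator_eq (k := k) (fun j => ∑ i, A i j)
      (fun j => by have := hcA j k; rwa [prefixSum_of_le _ le_rfl] at this)
      (by rw [Finset.sum_comm]; simp [hrA])
    have hlast : B (Fin.last k) = fun j : Fin m => tupleIndicator t' j - tupleIndicator t j := by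
      funext j
      have := (hc j).2
      rw [Fin.sum_univ_castSucc] at this
      rw [← this, ← hAt j]
      simp [hA, Fin.init]
    have hint := (zeroOnePrefixes_sub_tupleIndicator hmono ht' htm hm').1 (hlast ▸ (hr _).1)
    refine ⟨⟨t, A⟩, ?_, ?_⟩
    · simp only [Finset.mem_sigma, Finset.mem_filter, Fintype.mem_piFinset, mem_partialASM, mem_Icc]
      exact ⟨⟨hint, hmono⟩, hrA, fun j => ⟨hcA j, hAt j⟩⟩
    · simp only
      rw [← hlast]
      exact hBA.symm
  · intro p _
    rfl

/-- The number of generalized inversions of a rectangular array. -/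
def rectNu {k m : ℕ} (A : Fin k → Fin m → ℤ) : ℤ :=
  ∑ i, ∑ i', ∑ j, ∑ j', if i < i' ∧ j' ≤ j then A i j * A i' j' else 0

/-- The weight of a rectangular array. -/
def rectWeight {k m : ℕ} (x : K) (M : ℕ → ℕ → K) (A : Fin k → Fin m → ℤ) : K :=
  x ^ rectNu A * (1 + x) ^ #{p : Fin k × Fin m | A p.1 p.2 = -1} *
    ∏ i : Fin k, ∏ j : Fin m, M i j ^ A i j

theorem sum_mul_prefixSum {m : ℕ} (u v : Fin m → ℤ) :
    ∑ j : Fin m, u j * prefixSum v (j + 1) = ∑ j, ∑ j', if j' ≤ j then u j * v j' else 0 := by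
  refine Finset.sum_congr rfl fun j _ => ?_
  rw [prefixSum, Finset.mul_sum]
  refine Finset.sum_congr rfl fun l _ => ?_
  rw [mul_ite, mul_zero]
  congr 1
  rw [Fin.le_def, Nat.lt_succ_iff]

/-- Each new pair has its lower entry in the added row, so the upper entries contribute only through
their column sums. -/
theorem rectNu_snoc {k m : ℕ} (A : Fin k → Fin m → ℤ) (v : Fin m → ℤ) :
    rectNu (Fin.snoc (α := fun _ => Fin m → ℤ) A v : Fin (k + 1) → Fin m → ℤ) =
      rectNu A + ∑ j : Fin m, (∑ i, A i j) * prefixSum v (j + 1) := by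
  rw [sum_mul_prefixSum, rectNu, Fin.sum_univ_castSucc]
  simp only [Fin.sum_univ_castSucc, Fin.snoc_castSucc, Fin.snoc_last, Fin.castSucc_lt_castSucc_iff,
    Fin.castSucc_lt_last, true_and, lt_irrefl, false_and, if_false, Finset.sum_const_zero,
    (Fin.castSucc_lt_last _).not_gt, add_zero]
  rw [Finset.sum_add_distrib, rectNu]
  congr 1
  rw [Finset.sum_comm]
  refine Finset.sum_congr rfl fun j _ => ?_
  rw [Finset.sum_comm]
  refine Finset.sum_congr rfl fun l _ => ?_
  split_ifs
  · rw [Finset.sum_mul]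
  · simp

theorem rectWeight_snoc {k m : ℕ} {x : K} (hx : x ≠ 0) (M : ℕ → ℕ → K) (A : Fin k → Fin m → ℤ)
    (v : Fin m → ℤ) :
    rectWeight x M (Fin.snoc (α := fun _ => Fin m → ℤ) A v : Fin (k + 1) → Fin m → ℤ) =
      rectWeight x M A * (x ^ (∑ j : Fin m, (∑ i, A i j) * prefixSum v (j + 1)) *
        (1 + x) ^ #{j | v j = -1} * ∏ j : Fin m, M k j ^ v j) := by
  have hcard : #{p : Fin (k + 1) × Fin m |
        (Fin.snoc (α := fun _ => Fin m → ℤ) A v : Fin (k + 1) → Fin m → ℤ) p.1 p.2 = -1} =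
      #{p : Fin k × Fin m | A p.1 p.2 = -1} + #{j | v j = -1} := by
    simp only [Finset.card_filter, Fintype.sum_prod_type, Fin.sum_univ_castSucc,
      Fin.snoc_castSucc, Fin.snoc_last]
  rw [rectWeight, rectWeight, rectNu_snoc, hcard, zpow_add₀ hx, pow_add, Fin.prod_univ_castSucc]
  simp only [Fin.snoc_castSucc, Fin.snoc_last, Fin.val_castSucc, Fin.val_last]
  ring

theorem sum_partialASM_rectWeight {x : K} (hx : x ≠ 0) (M : ℕ → ℕ → K) (hM : ∀ i j, M i j ≠ 0)
    (k m : ℕ) (t : Fin k → ℕ) (ht : StrictMono t) (hm : ∀ b, t b < m) :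
    ∑ A ∈ partialASM k m t, rectWeight x M A = triangleSum x M k t := by
  induction k with
  | zero =>
    rw [Finset.sum_eq_single fun i => i.elim0]
    · simp [rectWeight, rectNu, triangleSum]
    · intro A _ hA
      exact absurd (Subsingleton.elim _ _) hA
    · intro h
      exact absurd (mem_partialASM.2 ⟨fun i => i.elim0, fun j =>
        ⟨fun i => Or.inl (by simp [prefixSum]), by simp [tupleIndicator]⟩⟩) h
  | succ k ih =>
    rw [sum_partialASM_succ ht hm, triangleSum]
    refine Finset.sum_congr rfl fun s hs => ?_
    simp only [Finset.mem_filter, Fintype.mem_piFinset, mem_Icc] at hs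
    have hsm (b : Fin k) : s b < m := (hs.1 b).2.trans_lt (hm _)
    rw [← ih s hs.2 hsm, Finset.mul_sum]
    refine Finset.sum_congr rfl fun A hA => ?_
    rw [mem_partialASM] at hA
    rw [rectWeight_snoc hx, mul_comm]
    congr 1
    simp only [(hA.2 _).2]
    exact row_weight_eq hx (M k) (hM k) hs.2 ht hsm hm hs.1 _ rfl

/-- The weighted sum over alternating sign matrices as a sum over monotone triangles. -/
theorem sum_ASM_rectWeight {x : K} (hx : x ≠ 0) (M : ℕ → ℕ → K) (hM : ∀ i j, M i j ≠ 0) (n : ℕ) :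
    ∑ A ∈ ASM n, rectWeight x M A = triangleSum x M n fun b => b := by
  rw [← sum_partialASM_rectWeight hx M hM n n (fun b => b) (fun a b h => h) fun b => b.is_lt]
  refine Finset.sum_congr ?_ fun _ _ => rfl
  ext A
  have (j : Fin n) : tupleIndicator (fun b : Fin n => (b : ℕ)) j = 1 := by
    simp [tupleIndicator, Fin.val_inj]
  simp only [mem_ASM, isASM_iff, mem_partialASM, this]

theorem nuInt_eq_sum_prefixSum {n : ℕ} (A : Fin n → Fin n → ℤ) :
    nuInt A = ∑ i' : Fin n, ∑ j : Fin n,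
      prefixSum (fun i => A i j) i' * prefixSum (A i') (j + 1) := by
  rw [nuInt, Finset.sum_comm]
  refine Finset.sum_congr rfl fun i' _ => ?_
  rw [Finset.sum_comm]
  refine Finset.sum_congr rfl fun j _ => ?_
  rw [prefixSum, prefixSum, Finset.sum_mul_sum]
  refine Finset.sum_congr rfl fun i _ => Finset.sum_congr rfl fun l _ => ?_
  simp only [Fin.lt_def, Fin.le_def, Nat.lt_succ_iff]
  split_ifs <;> simp_all

/-- Guarantees that the truncation in `nu` is harmless, so that `x ^ nu A` agrees with the integer
power in `rectWeight`. -/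
theorem nuInt_nonneg {n : ℕ} {A : Fin n → Fin n → ℤ} (hA : IsASM A) : 0 ≤ nuInt A := by
  rw [isASM_iff] at hA
  rw [nuInt_eq_sum_prefixSum]
  refine Finset.sum_nonneg fun i _ => Finset.sum_nonneg fun j _ => mul_nonneg ?_ ?_
  · rcases (hA.2 j).1 i with h | h <;> simp [h]
  · rcases (hA.1 i).1 (j + 1) with h | h <;> simp [h]

/-! ### Boundary statistics as weights -/

theorem exists_eq_single {m : ℕ} (s : Fin m → ℤ) (hs : ∀ j, s j = 0 ∨ s j = 1)
    (hk : ∑ j, s j = 1) : ∃ p, s = Pi.single p 1 := by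
  obtain ⟨t, _, htm, h⟩ := exists_tupleIndicator_eq (k := 1) s hs (by simpa using hk)
  refine ⟨⟨t 0, htm 0⟩, funext fun j => ?_⟩
  rw [h j, Pi.single_apply, tupleIndicator, Fin.sum_univ_one]
  simp [Fin.ext_iff, eq_comm]

theorem ZeroOnePrefixes.first {n : ℕ} {v : Fin (n + 1) → ℤ} (h : ZeroOnePrefixes v) :
    v 0 = 0 ∨ v 0 = 1 := by
  have h1 := h 1
  have h2 := prefixSum_succ v 0
  rw [Fin.val_zero, prefixSum_zero, zero_add, zero_add] at h2
  rwa [h2] at h1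

theorem ZeroOnePrefixes.last {n : ℕ} {v : Fin (n + 1) → ℤ} (h : ZeroOnePrefixes v)
    (hs : ∑ i, v i = 1) : v (Fin.last n) = 0 ∨ v (Fin.last n) = 1 := by
  have h1 := h n
  have h2 := prefixSum_succ v (Fin.last n)
  rw [Fin.val_last, prefixSum_of_le v le_rfl, hs] at h2
  omega

/-- Positions of the ones on the boundary of an alternating sign matrix. -/
theorem IsASM.exists_boundary {n : ℕ} {A : Fin (n + 1) → Fin (n + 1) → ℤ} (hA : IsASM A) :
    (∃ p, A 0 = Pi.single p 1) ∧ (∃ p, (fun i => A i (Fin.last n)) = Pi.single p 1) ∧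
      (∃ p, A (Fin.last n) = Pi.single p 1) ∧ ∃ p, (fun i => A i 0) = Pi.single p 1 := by
  rw [isASM_iff] at hA
  obtain ⟨hr, hc⟩ := hA
  exact ⟨exists_eq_single _ (fun j => (hc j).1.first) (hr 0).2,
    exists_eq_single _ (fun i => (hr i).1.last (hr i).2) (hc _).2,
    exists_eq_single _ (fun j => (hc j).1.last (hc j).2) (hr _).2,
    exists_eq_single _ (fun i => (hr i).1.first) (hc 0).2⟩

theorem prod_zpow_single {m : ℕ} (p : Fin m) (g : Fin m → K) :
    ∏ j, g j ^ (Pi.single p (1 : ℤ) : Fin m → ℤ) j = g p := by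
  rw [Finset.prod_eq_single p]
  · simp
  · intro j _ hj
    simp [hj]
  · simp

theorem card_left_of_single {m : ℕ} (p : Fin m) (v : Fin m → ℤ) (hv : v = Pi.single p 1) :
    #{j | ∃ k, j < k ∧ v j = 0 ∧ v k = 1} = (p : ℕ) := by
  rw [← Fin.card_Iio p]
  congr 1
  ext j
  simp only [mem_filter, mem_univ, true_and, mem_Iio, hv, Pi.single_apply]
  constructor
  · rintro ⟨k, hjk, _, hk⟩
    split_ifs at hk with h
    · exact h ▸ hjk
    · simp at hk
  · exact fun h => ⟨p, h, by simp [h.ne], by simp⟩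

theorem card_right_of_single {m : ℕ} (p : Fin m) (v : Fin m → ℤ) (hv : v = Pi.single p 1) :
    #{j | ∃ k, k < j ∧ v j = 0 ∧ v k = 1} = m - 1 - (p : ℕ) := by
  rw [← Fin.card_Ioi p]
  congr 1
  ext j
  simp only [mem_filter, mem_univ, true_and, mem_Ioi, hv, Pi.single_apply]
  constructor
  · rintro ⟨k, hjk, _, hk⟩
    split_ifs at hk with h
    · exact h ▸ hjk
    · simp at hk
  · exact fun h => ⟨p, h, by simp [h.ne'], by simp⟩

/-- The matrix of weights for which the weight of an alternating sign matrix records the positions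
of its ones on the boundary. -/
def boundaryWeight (n : ℕ) (z₁ z₂ z₃ z₄ : K) (i j : ℕ) : K :=
  (if i = 0 then z₁ ^ j else 1) * (if j + 1 = n then z₂ ^ (n - 1 - i) else 1) *
    (if i + 1 = n then z₃ ^ (n - 1 - j) else 1) * (if j = 0 then z₄ ^ i else 1)

theorem boundaryWeight_ne_zero {n : ℕ} {z₁ z₂ z₃ z₄ : K} (h₁ : z₁ ≠ 0) (h₂ : z₂ ≠ 0)
    (h₃ : z₃ ≠ 0) (h₄ : z₄ ≠ 0) (i j : ℕ) : boundaryWeight n z₁ z₂ z₃ z₄ i j ≠ 0 := by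
  unfold boundaryWeight
  refine mul_ne_zero (mul_ne_zero (mul_ne_zero ?_ ?_) ?_) ?_ <;> split_ifs <;> simp [*]

theorem prod_ite_row_zpow {k m : ℕ} (i₀ : Fin k) (g : Fin m → K) (A : Fin k → Fin m → ℤ) :
    ∏ i, ∏ j, (if i = i₀ then g j else 1) ^ A i j = ∏ j, g j ^ A i₀ j := by
  rw [Finset.prod_eq_single i₀]
  · simp
  · intro i _ hi
    simp [hi]
  · simp

theorem prod_boundaryWeight {n : ℕ} {A : Fin (n + 1) → Fin (n + 1) → ℤ} (hA : IsASM A)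
    (z₁ z₂ z₃ z₄ : K) :
    ∏ i : Fin (n + 1), ∏ j : Fin (n + 1), boundaryWeight (n + 1) z₁ z₂ z₃ z₄ i j ^ A i j =
      z₁ ^ rhoT A * z₂ ^ rhoR A * z₃ ^ rhoB A * z₄ ^ rhoL A := by
  obtain ⟨⟨p₁, h₁⟩, ⟨p₂, h₂⟩, ⟨p₃, h₃⟩, p₄, h₄⟩ := hA.exists_boundary
  have hz (i : Fin (n + 1)) : (i : ℕ) = 0 ↔ i = 0 := by rw [Fin.ext_iff, Fin.val_zero]
  have hl (i : Fin (n + 1)) : (i : ℕ) + 1 = n + 1 ↔ i = Fin.last n := by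
    rw [Fin.ext_iff, Fin.val_last, Nat.add_right_cancel_iff]
  have hT : rhoT A = p₁ := by
    rw [← card_left_of_single p₁ _ h₁, rhoT]
    simp only [hz, exists_and_left, exists_eq_left]
  have hR : rhoR A = n - p₂ := by
    have := card_right_of_single p₂ _ h₂
    rw [Nat.add_sub_cancel] at this
    rw [← this, rhoR]
    simp only [hl, exists_and_left, exists_eq_left]
  have hB : rhoB A = n - p₃ := by
    have := card_right_of_single p₃ _ h₃
    rw [Nat.add_sub_cancel] at this
    rw [← this, rhoB]
    simp only [hl, exists_and_left, exists_eq_left]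
  have hL : rhoL A = p₄ := by
    rw [← card_left_of_single p₄ _ h₄, rhoL]
    simp only [hz, exists_and_left, exists_eq_left]
  simp only [boundaryWeight, hz, hl, mul_zpow, Finset.prod_mul_distrib, Nat.add_sub_cancel]
  rw [hT, hR, hB, hL]
  congr 1
  · congr 1
    · congr 1
      · rw [prod_ite_row_zpow, h₁, prod_zpow_single p₁ fun j => z₁ ^ (j : ℕ)]
      · rw [Finset.prod_comm, prod_ite_row_zpow (Fin.last n) (fun i => z₂ ^ (n - (i : ℕ)))
          fun j i => A i j]
        simp only [congrFun h₂]
        rw [prod_zpow_single p₂ fun j => z₂ ^ (n - (j : ℕ))]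
    · rw [prod_ite_row_zpow, h₃, prod_zpow_single p₃ fun j => z₃ ^ (n - (j : ℕ))]
  · rw [Finset.prod_comm, prod_ite_row_zpow 0 (fun i => z₄ ^ (i : ℕ)) fun j i => A i j]
    simp only [congrFun h₄]
    rw [prod_zpow_single p₄ fun j => z₄ ^ (j : ℕ)]

/-- The empty matrix occurs as the central factor when the condensation produces size 2. -/
theorem Zqua_zero {R : Type*} [CommRing R] (x y z₁ z₂ z₃ z₄ : R) :
    Zqua 0 x y z₁ z₂ z₃ z₄ = 1 := by
  have : ASM 0 = {fun i => i.elim0} := by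
    ext A
    simp only [mem_ASM, isASM_iff, Finset.mem_singleton]
    exact iff_of_true ⟨fun i => i.elim0, fun i => i.elim0⟩ (Subsingleton.elim _ _)
  rw [Zqua, this, Finset.sum_singleton]
  simp [nu, nuInt, mu, rhoT, rhoR, rhoB, rhoL]

theorem Zqua_eq_sum_rectWeight (x z₁ z₂ z₃ z₄ : K) (n : ℕ) :
    Zqua n x (x + 1) z₁ z₂ z₃ z₄ =
      ∑ A ∈ ASM n, rectWeight x (boundaryWeight n z₁ z₂ z₃ z₄) A := by
  refine Finset.sum_congr rfl fun A hA => ?_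
  rw [mem_ASM] at hA
  have h1 : x ^ nu A = x ^ rectNu A := by
    change _ = x ^ nuInt A
    rw [← zpow_natCast, nu, Int.toNat_of_nonneg (nuInt_nonneg hA)]
  rw [rectWeight, ← h1, mu, add_comm x 1]
  cases n with
  | zero => simp [rhoT, rhoR, rhoB, rhoL]
  | succ n => rw [prod_boundaryWeight hA]; ring

theorem Zqua_one {R : Type*} [CommRing R] (x y z₁ z₂ z₃ z₄ : R) :
    Zqua 1 x y z₁ z₂ z₃ z₄ = 1 := by
  have : ASM 1 = {fun _ _ => 1} := by
    decide
  have h0 : nuInt (fun _ _ : Fin 1 => 1) = 0 := by decide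
  rw [Zqua, this, Finset.sum_singleton]
  simp [nu, h0, mu, rhoT, rhoR, rhoB, rhoL]

/-! ### Condensation of the generating functions -/

theorem sum_rectWeight_congr (x : K) {M M' : ℕ → ℕ → K} {n : ℕ}
    (h : ∀ i < n, ∀ j < n, M i j = M' i j) :
    ∑ A ∈ ASM n, rectWeight x M A = ∑ A ∈ ASM n, rectWeight x M' A := by
  refine Finset.sum_congr rfl fun A _ => ?_
  rw [rectWeight, rectWeight]
  congr 1
  exact Finset.prod_congr rfl fun i _ => Finset.prod_congr rfl fun j _ => by
    rw [h i i.is_lt j j.is_lt]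

/-- Every row and column of the matrix sums to 1, so each scaling factor comes out exactly once. -/
theorem sum_rectWeight_scale (x : K) (M : ℕ → ℕ → K) (a b : ℕ → K) (ha : ∀ i, a i ≠ 0)
    (hb : ∀ i, b i ≠ 0) (n : ℕ) :
    ∑ A ∈ ASM n, rectWeight x (fun i j => a i * b j * M i j) A =
      (∏ i ∈ range n, a i) * (∏ j ∈ range n, b j) * ∑ A ∈ ASM n, rectWeight x M A := by
  rw [Finset.mul_sum]
  refine Finset.sum_congr rfl fun A hA => ?_
  rw [mem_ASM, isASM_iff] at hA
  have h1 : ∏ i : Fin n, ∏ j : Fin n, a i ^ A i j = ∏ i ∈ range n, a i := by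
    rw [Finset.prod_range]
    refine Finset.prod_congr rfl fun i _ => ?_
    rw [← zpow_sum_eq_prod (ha i), (hA.1 i).2, zpow_one]
  have h2 : ∏ i : Fin n, ∏ j : Fin n, b j ^ A i j = ∏ j ∈ range n, b j := by
    rw [Finset.prod_range, Finset.prod_comm]
    refine Finset.prod_congr rfl fun j _ => ?_
    rw [← zpow_sum_eq_prod (hb j), (hA.2 j).2, zpow_one]
  simp only [rectWeight, mul_zpow, Finset.prod_mul_distrib, h1, h2]
  ring

/-- Condensation for weighted sums over alternating sign matrices. -/
theorem sum_ASM_condensation {x : K} (hx : x ≠ 0) (M : ℕ → ℕ → K) (hM : ∀ i j, M i j ≠ 0)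
    (m : ℕ) :
    (∑ A ∈ ASM (m + 2), rectWeight x M A) *
        ∑ A ∈ ASM m, rectWeight x (fun i j => M (i + 1) (j + 1)) A =
      (∑ A ∈ ASM (m + 1), rectWeight x M A) *
          ∑ A ∈ ASM (m + 1), rectWeight x (fun i j => M (i + 1) (j + 1)) A +
        x * ((∑ A ∈ ASM (m + 1), rectWeight x (fun i j => M i (j + 1)) A) *
          ∑ A ∈ ASM (m + 1), rectWeight x (fun i => M (i + 1)) A) := by
  rw [sum_ASM_rectWeight hx _ hM, sum_ASM_rectWeight hx _ fun i j => hM _ _,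
    sum_ASM_rectWeight hx _ hM, sum_ASM_rectWeight hx _ fun i j => hM _ _,
    sum_ASM_rectWeight hx _ fun i j => hM _ _, sum_ASM_rectWeight hx _ fun i j => hM _ _,
    triangleSum_translate x (fun i => M (i + 1)), triangleSum_translate x (fun i => M (i + 1)),
    triangleSum_translate]
  exact triangleSum_condensation x hx M hM m

/-- Condensation for the quadruply-refined generating function. -/
theorem Zqua_condensation {x z₁ z₂ z₃ z₄ : K} (hx : x ≠ 0) (h₁ : z₁ ≠ 0) (h₂ : z₂ ≠ 0)
    (h₃ : z₃ ≠ 0) (h₄ : z₄ ≠ 0) (m : ℕ) :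
    Zqua (m + 2) x (x + 1) z₁ z₂ z₃ z₄ * Zqua m x (x + 1) 1 1 1 1 =
      Zqua (m + 1) x (x + 1) z₁ 1 1 z₄ * Zqua (m + 1) x (x + 1) 1 z₂ z₃ 1 +
        x * z₁ * z₂ * z₃ * z₄ *
          (Zqua (m + 1) x (x + 1) z₁ z₂ 1 1 * Zqua (m + 1) x (x + 1) 1 1 z₃ z₄) := by
  have key := sum_ASM_condensation hx _ (boundaryWeight_ne_zero (n := m + 2) h₁ h₂ h₃ h₄) m
  rw [← Zqua_eq_sum_rectWeight] at key
  have e0 : ∑ A ∈ ASM m, rectWeight x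
      (fun i j => boundaryWeight (m + 2) z₁ z₂ z₃ z₄ (i + 1) (j + 1)) A =
      Zqua m x (x + 1) 1 1 1 1 := by
    rw [Zqua_eq_sum_rectWeight]
    refine sum_rectWeight_congr x fun i hi j hj => ?_
    simp [boundaryWeight, hi.ne, hj.ne]
  have e1 : ∑ A ∈ ASM (m + 1), rectWeight x (boundaryWeight (m + 2) z₁ z₂ z₃ z₄) A =
      Zqua (m + 1) x (x + 1) z₁ 1 1 z₄ := by
    rw [Zqua_eq_sum_rectWeight]
    refine sum_rectWeight_congr x fun i hi j hj => ?_
    simp [boundaryWeight, hi.ne, hj.ne]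
  have e2 : ∑ A ∈ ASM (m + 1), rectWeight x
      (fun i j => boundaryWeight (m + 2) z₁ z₂ z₃ z₄ (i + 1) (j + 1)) A =
      Zqua (m + 1) x (x + 1) 1 z₂ z₃ 1 := by
    rw [Zqua_eq_sum_rectWeight]
    refine sum_rectWeight_congr x fun i hi j hj => ?_
    simp [boundaryWeight]
  -- Away from the main diagonal corners, the block's boundary exponents exceed those of size m+1 by
  -- one; scaling one row and one column extracts the factor `z₁ * z₂`.
  have e3 : ∑ A ∈ ASM (m + 1), rectWeight x
      (fun i j => boundaryWeight (m + 2) z₁ z₂ z₃ z₄ i (j + 1)) A =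
      z₁ * z₂ * Zqua (m + 1) x (x + 1) z₁ z₂ 1 1 := by
    have := sum_rectWeight_scale x (boundaryWeight (m + 1) z₁ z₂ 1 1)
      (fun i => if i = 0 then z₁ else 1) (fun j => if j = m then z₂ else 1)
      (fun i => by split_ifs <;> simp [h₁]) (fun i => by split_ifs <;> simp [h₂]) (m + 1)
    rw [← Zqua_eq_sum_rectWeight] at this
    simp only [Finset.prod_ite_eq', mem_range, Nat.succ_pos, Nat.lt_succ_self, if_true] at this
    rw [← this]
    refine sum_rectWeight_congr x fun i hi j hj => ?_
    have h : m + 2 - 1 - i = m + 1 - 1 - i + 1 := by omega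
    have h' : ¬ i + 1 = m + 2 := by omega
    simp only [boundaryWeight, h, h', Nat.add_right_cancel_iff, Nat.succ_ne_zero, if_false, one_pow,
      ite_self, mul_one, pow_succ]
    split_ifs <;> ring
  have e4 : ∑ A ∈ ASM (m + 1), rectWeight x
      (fun i => boundaryWeight (m + 2) z₁ z₂ z₃ z₄ (i + 1)) A =
      z₃ * z₄ * Zqua (m + 1) x (x + 1) 1 1 z₃ z₄ := by
    have := sum_rectWeight_scale x (boundaryWeight (m + 1) 1 1 z₃ z₄)
      (fun i => if i = m then z₃ else 1) (fun j => if j = 0 then z₄ else 1)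
      (fun i => by split_ifs <;> simp [h₃]) (fun i => by split_ifs <;> simp [h₄]) (m + 1)
    rw [← Zqua_eq_sum_rectWeight] at this
    simp only [Finset.prod_ite_eq', mem_range, Nat.succ_pos, Nat.lt_succ_self, if_true] at this
    rw [← this]
    refine sum_rectWeight_congr x fun i hi j hj => ?_
    have h : m + 2 - 1 - j = m + 1 - 1 - j + 1 := by omega
    have h' : ¬ j + 1 = m + 2 := by omega
    simp only [boundaryWeight, h, h', Nat.add_right_cancel_iff, Nat.succ_ne_zero, if_false, one_pow,
      ite_self, mul_one, pow_succ]
    split_ifs <;> ring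
  rw [e0, e1, e2, e3, e4] at key
  rw [key]
  ring

/-! ### Solving the recursions -/

theorem halfProd_add_one (a : ℕ) : halfProd ((a : ℤ) + 1) = halfProd a + a := by
  have h1 := two_mul_halfProd ((a : ℤ) + 1)
  have h2 := two_mul_halfProd (a : ℤ)
  zify
  linarith

theorem halfProd_mul_shift (m : ℤ) :
    halfProd (m + 1) + halfProd (m - 1) = 2 * halfProd m + 1 := by
  have h1 := two_mul_halfProd (m + 1)
  have h2 := two_mul_halfProd m
  have h3 := two_mul_halfProd (m - 1)
  zify
  linarith

theorem halfProd_pred (m : ℕ) :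
    halfProd ((m : ℤ) - 1) + m = halfProd m + 1 := by
  have h2 := two_mul_halfProd (m : ℤ)
  have h3 := two_mul_halfProd ((m : ℤ) - 1)
  zify
  linarith

section ClosedForms

variable {x : K}

/-- The recursion reads Z_{m+2} Z_m = (x+1) Z_{m+1}², which the second difference 1 of the exponents
solves. -/
theorem Zqua_ones (hx : x ≠ 0) (hy : x + 1 ≠ 0) (n : ℕ) :
    Zqua n x (x + 1) 1 1 1 1 = (x + 1) ^ halfProd (n : ℤ) := by
  induction n using Nat.strong_induction_on with
  | _ n ih =>
    match n with
    | 0 => rw [Zqua_zero]; simp [halfProd]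
    | 1 => rw [Zqua_one]; simp [halfProd]
    | m + 2 =>
      have h := Zqua_condensation hx one_ne_zero one_ne_zero one_ne_zero one_ne_zero m
      rw [ih (m + 1) (by omega), ih m (by omega)] at h
      apply mul_right_cancel₀ (pow_ne_zero (halfProd (m : ℤ)) hy)
      rw [h]
      have h1 : halfProd (((m + 1 : ℕ) : ℤ) + 1) + halfProd (((m + 1 : ℕ) : ℤ) - 1) =
        2 * halfProd ((m + 1 : ℕ) : ℤ) + 1 := halfProd_mul_shift _
      have h2 : ((m + 1 : ℕ) : ℤ) - 1 = m := by push_cast; ring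
      have h3 : ((m + 1 : ℕ) : ℤ) + 1 = ((m + 2 : ℕ) : ℤ) := by push_cast; ring
      rw [h2, h3] at h1
      rw [← pow_add _ (halfProd ((m + 2 : ℕ) : ℤ)), h1]
      ring

/-- Solution of the recursion for one refined boundary. -/
theorem single_closed_form (hy : x + 1 ≠ 0) (z : K) (f : ℕ → K) (h1 : f 1 = 1)
    (hf : ∀ m : ℕ, f (m + 2) * (x + 1) ^ halfProd (m : ℤ) =
      f (m + 1) * (x + 1) ^ halfProd ((m + 1 : ℕ) : ℤ) +
        x * z * (f (m + 1) * (x + 1) ^ halfProd ((m + 1 : ℕ) : ℤ))) (m : ℕ) :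
    f (m + 1) = (x * z + 1) ^ m * (x + 1) ^ halfProd (m : ℤ) := by
  induction m with
  | zero => simp [h1, halfProd]
  | succ m ih =>
    apply mul_right_cancel₀ (pow_ne_zero (halfProd (m : ℤ)) hy)
    rw [hf, ih]
    ring

theorem Zqua_single (hx : x ≠ 0) (hy : x + 1 ≠ 0) {z : K} (hz : z ≠ 0) (m : ℕ) :
    Zqua (m + 1) x (x + 1) z 1 1 1 = (x * z + 1) ^ m * (x + 1) ^ halfProd (m : ℤ) ∧
    Zqua (m + 1) x (x + 1) 1 z 1 1 = (x * z + 1) ^ m * (x + 1) ^ halfProd (m : ℤ) ∧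
    Zqua (m + 1) x (x + 1) 1 1 z 1 = (x * z + 1) ^ m * (x + 1) ^ halfProd (m : ℤ) ∧
    Zqua (m + 1) x (x + 1) 1 1 1 z = (x * z + 1) ^ m * (x + 1) ^ halfProd (m : ℤ) := by
  have h1 : (1 : K) ≠ 0 := one_ne_zero
  refine ⟨single_closed_form hy z (fun n => Zqua n x (x + 1) z 1 1 1) (Zqua_one ..) (fun m => ?_) m,
    single_closed_form hy z (fun n => Zqua n x (x + 1) 1 z 1 1) (Zqua_one ..) (fun m => ?_) m,
    single_closed_form hy z (fun n => Zqua n x (x + 1) 1 1 z 1) (Zqua_one ..) (fun m => ?_) m,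
    single_closed_form hy z (fun n => Zqua n x (x + 1) 1 1 1 z) (Zqua_one ..) (fun m => ?_) m⟩
  · have h := Zqua_condensation hx hz h1 h1 h1 m
    simp only [Zqua_ones hx hy] at h
    linear_combination h
  · have h := Zqua_condensation hx h1 hz h1 h1 m
    simp only [Zqua_ones hx hy] at h
    linear_combination h
  · have h := Zqua_condensation hx h1 h1 hz h1 m
    simp only [Zqua_ones hx hy] at h
    linear_combination h
  · have h := Zqua_condensation hx h1 h1 h1 hz m
    simp only [Zqua_ones hx hy] at h
    linear_combination h

/-- Solution of the recursion for two boundaries that meet in the first or last diagonal entry. -/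
theorem adjacent_closed_form (hy : x + 1 ≠ 0) (a b : K) (f : ℕ → K) (h1 : f 1 = 1)
    (hf : ∀ m : ℕ, f (m + 2) * (x + 1) ^ halfProd (m : ℤ) =
      f (m + 1) * (x + 1) ^ halfProd ((m + 1 : ℕ) : ℤ) +
        x * a * b * (((x * a + 1) ^ m * (x + 1) ^ halfProd (m : ℤ)) *
          ((x * b + 1) ^ m * (x + 1) ^ halfProd (m : ℤ)))) (m : ℕ) :
    (x * a * b + a + b - 1) * f (m + 1) =
      a * b * ((x * a + 1) * (x * b + 1)) ^ m * (x + 1) ^ halfProd ((m : ℤ) - 1) -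
        (a - 1) * (b - 1) * (x + 1) ^ halfProd (m : ℤ) := by
  induction m with
  | zero =>
    -- Here `halfProd (-1) = 1`, so the base case is the identity xab + a + b - 1 = ab(x+1) -
    -- (a-1)(b-1).
    simp [h1, halfProd]
    ring
  | succ m ih =>
    have e1 : (x + 1) ^ halfProd ((m + 1 : ℕ) : ℤ) = (x + 1) ^ halfProd (m : ℤ) * (x + 1) ^ m := by
      rw [Nat.cast_succ, halfProd_add_one, pow_add]
    have e2 : (x + 1) ^ halfProd ((m : ℤ) - 1) * (x + 1) ^ m =
        (x + 1) ^ halfProd (m : ℤ) * (x + 1) := by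
      rw [← pow_add, halfProd_pred, pow_succ]
    have e3 : ((m + 1 : ℕ) : ℤ) - 1 = m := by push_cast; ring
    have hm := hf m
    rw [e1] at hm
    rw [e3, e1]
    apply mul_right_cancel₀ (pow_ne_zero (halfProd (m : ℤ)) hy)
    generalize (x + 1) ^ halfProd (m : ℤ) = E at *
    generalize (x + 1) ^ halfProd ((m : ℤ) - 1) = F at *
    rw [mul_assoc, hm]
    simp only [mul_pow, pow_succ] at *
    linear_combination E * (x + 1) ^ m * ih + a * b * (x * a + 1) ^ m * (x * b + 1) ^ m * E * e2

/-- Solution of the recursion for two boundaries that meet off the diagonal. -/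
theorem opposite_closed_form (hy : x + 1 ≠ 0) (a b : K) (f : ℕ → K) (h1 : f 1 = 1)
    (hf : ∀ m : ℕ, f (m + 2) * (x + 1) ^ halfProd (m : ℤ) =
      ((x * a + 1) ^ m * (x + 1) ^ halfProd (m : ℤ)) *
          ((x * b + 1) ^ m * (x + 1) ^ halfProd (m : ℤ)) +
        x * a * b * (f (m + 1) * (x + 1) ^ halfProd ((m + 1 : ℕ) : ℤ))) (m : ℕ) :
    (x * a * b - x * a - x * b - 1) * f (m + 1) =
      (a - 1) * (b - 1) * (a * b) ^ m * x ^ (m + 1) * (x + 1) ^ halfProd (m : ℤ) -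
        ((x * a + 1) * (x * b + 1)) ^ m * (x + 1) ^ halfProd ((m : ℤ) - 1) := by
  induction m with
  | zero =>
    -- Again `halfProd (-1) = 1`: the base case is xab - xa - xb - 1 = (a-1)(b-1)x - (x+1).
    simp [h1, halfProd]
    ring
  | succ m ih =>
    have e1 : (x + 1) ^ halfProd ((m + 1 : ℕ) : ℤ) = (x + 1) ^ halfProd (m : ℤ) * (x + 1) ^ m := by
      rw [Nat.cast_succ, halfProd_add_one, pow_add]
    have e2 : (x + 1) ^ halfProd ((m : ℤ) - 1) * (x + 1) ^ m =
        (x + 1) ^ halfProd (m : ℤ) * (x + 1) := by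
      rw [← pow_add, halfProd_pred, pow_succ]
    have e3 : ((m + 1 : ℕ) : ℤ) - 1 = m := by push_cast; ring
    have hm := hf m
    rw [e1] at hm
    rw [e3, e1]
    apply mul_right_cancel₀ (pow_ne_zero (halfProd (m : ℤ)) hy)
    generalize (x + 1) ^ halfProd (m : ℤ) = E at *
    generalize (x + 1) ^ halfProd ((m : ℤ) - 1) = F at *
    rw [mul_assoc, hm]
    simp only [mul_pow, pow_succ] at *
    linear_combination x * a * b * E * (x + 1) ^ m * ih -
      x * a * b * (x * a + 1) ^ m * (x * b + 1) ^ m * E * e2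

theorem Zqua_adjacent (hx : x ≠ 0) (hy : x + 1 ≠ 0) {a b : K} (ha : a ≠ 0) (hb : b ≠ 0) (m : ℕ) :
    ((x * a * b + a + b - 1) * Zqua (m + 1) x (x + 1) a 1 1 b =
      a * b * ((x * a + 1) * (x * b + 1)) ^ m * (x + 1) ^ halfProd ((m : ℤ) - 1) -
        (a - 1) * (b - 1) * (x + 1) ^ halfProd (m : ℤ)) ∧
    (x * a * b + a + b - 1) * Zqua (m + 1) x (x + 1) 1 a b 1 =
      a * b * ((x * a + 1) * (x * b + 1)) ^ m * (x + 1) ^ halfProd ((m : ℤ) - 1) -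
        (a - 1) * (b - 1) * (x + 1) ^ halfProd (m : ℤ) := by
  have h1 : (1 : K) ≠ 0 := one_ne_zero
  refine ⟨adjacent_closed_form hy a b (fun n => Zqua n x (x + 1) a 1 1 b) (Zqua_one ..)
      (fun m => ?_) m,
    adjacent_closed_form hy a b (fun n => Zqua n x (x + 1) 1 a b 1) (Zqua_one ..) (fun m => ?_) m⟩
  · have h := Zqua_condensation hx ha h1 h1 hb m
    rw [Zqua_ones hx hy, Zqua_ones hx hy, (Zqua_single hx hy ha m).1,
      (Zqua_single hx hy hb m).2.2.2] at h
    linear_combination h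
  · have h := Zqua_condensation hx h1 ha hb h1 m
    rw [Zqua_ones hx hy, Zqua_ones hx hy, (Zqua_single hx hy ha m).2.1,
      (Zqua_single hx hy hb m).2.2.1] at h
    linear_combination h

theorem Zqua_opposite (hx : x ≠ 0) (hy : x + 1 ≠ 0) {a b : K} (ha : a ≠ 0) (hb : b ≠ 0) (m : ℕ) :
    ((x * a * b - x * a - x * b - 1) * Zqua (m + 1) x (x + 1) a b 1 1 =
      (a - 1) * (b - 1) * (a * b) ^ m * x ^ (m + 1) * (x + 1) ^ halfProd (m : ℤ) -
        ((x * a + 1) * (x * b + 1)) ^ m * (x + 1) ^ halfProd ((m : ℤ) - 1)) ∧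
    (x * a * b - x * a - x * b - 1) * Zqua (m + 1) x (x + 1) 1 1 a b =
      (a - 1) * (b - 1) * (a * b) ^ m * x ^ (m + 1) * (x + 1) ^ halfProd (m : ℤ) -
        ((x * a + 1) * (x * b + 1)) ^ m * (x + 1) ^ halfProd ((m : ℤ) - 1) := by
  have h1 : (1 : K) ≠ 0 := one_ne_zero
  refine ⟨opposite_closed_form hy a b (fun n => Zqua n x (x + 1) a b 1 1) (Zqua_one ..)
      (fun m => ?_) m,
    opposite_closed_form hy a b (fun n => Zqua n x (x + 1) 1 1 a b) (Zqua_one ..) (fun m => ?_) m⟩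
  · have h := Zqua_condensation hx ha hb h1 h1 m
    rw [Zqua_ones hx hy, Zqua_ones hx hy, (Zqua_single hx hy ha m).1,
      (Zqua_single hx hy hb m).2.1] at h
    linear_combination h
  · have h := Zqua_condensation hx h1 h1 ha hb m
    rw [Zqua_ones hx hy, Zqua_ones hx hy, (Zqua_single hx hy ha m).2.2.1,
      (Zqua_single hx hy hb m).2.2.2] at h
    linear_combination h

/-- No induction is needed: every factor on the right of the condensation is known. The two main
terms merge by r - x z₂ p = -(x z₃ + 1)(x z₁ z₂ + 1), where p and r are the two prefactors on the
left, in that order. -/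
theorem Zqua_triple (hx : x ≠ 0) (hy : x + 1 ≠ 0) {z₁ z₂ z₃ : K} (h₁ : z₁ ≠ 0) (h₂ : z₂ ≠ 0)
    (h₃ : z₃ ≠ 0) (m : ℕ) :
    (x * z₁ * z₃ + z₁ + z₃ - 1) * (x * z₂ * z₃ - x * z₂ - x * z₃ - 1) *
        Zqua (m + 2) x (x + 1) z₁ 1 z₂ z₃ =
      -(z₁ * z₃ * (x * z₁ * z₂ + 1) * ((x * z₁ + 1) * (x * z₂ + 1)) ^ m *
          (x * z₃ + 1) ^ (m + 1) * (x + 1) ^ halfProd ((m : ℤ) - 1))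
        + (z₂ - 1) * (z₃ - 1) * (x * z₁ * z₃ + z₁ + z₃ - 1) * z₁ * (z₂ * z₃) ^ (m + 1) *
          (x * z₁ + 1) ^ m * x ^ (m + 2) * (x + 1) ^ halfProd (m : ℤ)
        - (z₁ - 1) * (z₃ - 1) * (x * z₂ * z₃ - x * z₂ - x * z₃ - 1) *
          (x * z₂ + 1) ^ m * (x + 1) ^ halfProd (m : ℤ) := by
  have h := Zqua_condensation hx h₁ one_ne_zero h₂ h₃ m
  have hP := (Zqua_adjacent hx hy h₁ h₃ m).1
  have hR := (Zqua_opposite hx hy h₂ h₃ m).2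
  rw [Zqua_ones hx hy, (Zqua_single hx hy h₁ m).1, (Zqua_single hx hy h₂ m).2.2.1] at h
  apply mul_right_cancel₀ (pow_ne_zero (halfProd (m : ℤ)) hy)
  generalize (x + 1) ^ halfProd (m : ℤ) = E at *
  generalize (x + 1) ^ halfProd ((m : ℤ) - 1) = F at *
  rw [mul_assoc _ _ E, h]
  simp only [mul_pow, pow_succ] at *
  linear_combination
    (x * z₂ * z₃ - x * z₂ - x * z₃ - 1) * (x * z₂ + 1) ^ m * E * hP +
    x * z₁ * z₂ * z₃ * (x * z₁ * z₃ + z₁ + z₃ - 1) * (x * z₁ + 1) ^ m * E * hR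

theorem Zqua_quadruple (hx : x ≠ 0) (hy : x + 1 ≠ 0) {z₁ z₂ z₃ z₄ : K} (h₁ : z₁ ≠ 0)
    (h₂ : z₂ ≠ 0) (h₃ : z₃ ≠ 0) (h₄ : z₄ ≠ 0) (m : ℕ) :
    (x * z₄ * z₁ + z₄ + z₁ - 1) * (x * z₁ * z₂ - x * z₁ - x * z₂ - 1) *
        (x * z₂ * z₃ + z₂ + z₃ - 1) * (x * z₃ * z₄ - x * z₃ - x * z₄ - 1) *
        Zqua (m + 2) x (x + 1) z₁ z₂ z₃ z₄ =
      z₁ * z₂ * z₃ * z₄ * (x * z₁ * z₃ + 1) * (x * z₂ * z₄ + 1) *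
          ((x * z₁ + 1) * (x * z₂ + 1) * (x * z₃ + 1) * (x * z₄ + 1)) ^ m *
          (x + 1) ^ halfProd ((m : ℤ) - 1 - 1)
        - ((z₂ - 1) * (z₃ - 1) * z₄ * z₁ * ((x * z₄ + 1) * (x * z₁ + 1)) ^ m
            + (z₄ - 1) * (z₁ - 1) * z₂ * z₃ * ((x * z₂ + 1) * (x * z₃ + 1)) ^ m) *
          (x * z₁ * z₂ - x * z₁ - x * z₂ - 1) * (x * z₃ * z₄ - x * z₃ - x * z₄ - 1) *
          (x + 1) ^ halfProd ((m : ℤ) - 1)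
        - ((z₃ - 1) * (z₄ - 1) * z₁ * z₂ * (z₃ * z₄) ^ (m + 1) *
              ((x * z₁ + 1) * (x * z₂ + 1)) ^ m
            + (z₁ - 1) * (z₂ - 1) * z₃ * z₄ * (z₁ * z₂) ^ (m + 1) *
              ((x * z₃ + 1) * (x * z₄ + 1)) ^ m) *
          (x * z₄ * z₁ + z₄ + z₁ - 1) * (x * z₂ * z₃ + z₂ + z₃ - 1) *
          x ^ (m + 2) * (x + 1) ^ halfProd ((m : ℤ) - 1)
        + (z₁ - 1) * (z₂ - 1) * (z₃ - 1) * (z₄ - 1) *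
          ((x * z₁ * z₂ - x * z₁ - x * z₂ - 1) * (x * z₃ * z₄ - x * z₃ - x * z₄ - 1)
            + (x * z₄ * z₁ + z₄ + z₁ - 1) * (x * z₂ * z₃ + z₂ + z₃ - 1) *
              (z₁ * z₂ * z₃ * z₄) ^ (m + 1) * x ^ (2 * m + 3)) *
          (x + 1) ^ halfProd (m : ℤ) := by
  have h := Zqua_condensation hx h₁ h₂ h₃ h₄ m
  have hP := (Zqua_adjacent hx hy h₁ h₄ m).1
  have hP' := (Zqua_adjacent hx hy h₂ h₃ m).2
  have hR := (Zqua_opposite hx hy h₁ h₂ m).1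
  have hR' := (Zqua_opposite hx hy h₃ h₄ m).2
  rw [Zqua_ones hx hy] at h
  -- The main terms of the two products merge by r₁₂ r₃₄ + x p₄₁ p₂₃ = (x+1)(x z₁ z₃ + 1)(x z₂ z₄ +
  -- 1), with p and r the adjacent and opposite prefactors. The spare factor x+1 is absorbed by this
  -- relation between the powers.
  have hE : (x + 1) ^ halfProd (m : ℤ) * (x + 1) ^ halfProd ((m : ℤ) - 1 - 1) =
      (x + 1) * ((x + 1) ^ halfProd ((m : ℤ) - 1)) ^ 2 := by
    have := halfProd_mul_shift ((m : ℤ) - 1)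
    rw [sub_add_cancel] at this
    rw [← pow_add, this]
    ring
  have key := congrArg₂ (· * ·) hP hP'
  have key' := congrArg₂ (· * ·) hR hR'
  apply mul_right_cancel₀ (pow_ne_zero (halfProd (m : ℤ)) hy)
  generalize (x + 1) ^ halfProd (m : ℤ) = E at *
  generalize (x + 1) ^ halfProd ((m : ℤ) - 1) = F at *
  generalize (x + 1) ^ halfProd ((m : ℤ) - 1 - 1) = G at *
  rw [mul_assoc _ _ E, h]
  have hpow : x ^ (2 * m + 3) = x ^ m * x ^ m * x ^ 3 := by ring
  rw [hpow]
  simp only [mul_pow, pow_succ x, pow_succ z₁, pow_succ z₂, pow_succ z₃, pow_succ z₄] at *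
  linear_combination
    (x * z₁ * z₂ - x * z₁ - x * z₂ - 1) * (x * z₃ * z₄ - x * z₃ - x * z₄ - 1) * key +
    x * z₁ * z₂ * z₃ * z₄ * (x * z₄ * z₁ + z₄ + z₁ - 1) * (x * z₂ * z₃ + z₂ + z₃ - 1) * key' -
    z₁ * z₂ * z₃ * z₄ * (x * z₁ * z₃ + 1) * (x * z₂ * z₄ + 1) *
      ((x * z₁ + 1) ^ m * (x * z₂ + 1) ^ m * (x * z₃ + 1) ^ m * (x * z₄ + 1) ^ m) * hE

end ClosedForms

/-! ### Transfer to arbitrary commutative rings -/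

theorem map_Zqua {R S : Type*} [CommRing R] [CommRing S] (f : R →+* S) (n : ℕ)
    (x y z₁ z₂ z₃ z₄ : R) :
    f (Zqua n x y z₁ z₂ z₃ z₄) = Zqua n (f x) (f y) (f z₁) (f z₂) (f z₃) (f z₄) := by
  simp [Zqua, map_sum]

/-- The three identities over a field, for arguments outside a hypersurface. -/
theorem Zqua_Ztri_Zadj_of_ne_zero {R : Type*} [Field R] (n : ℕ) (hn : 1 ≤ n) {x z₁ z₂ z₃ z₄ : R}
    (hx : x ≠ 0) (hy : x + 1 ≠ 0) (h₁ : z₁ ≠ 0) (h₂ : z₂ ≠ 0) (h₃ : z₃ ≠ 0) (h₄ : z₄ ≠ 0) :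
    (2 ≤ n →
      (x * z₄ * z₁ + z₄ + z₁ - 1) * (x * z₁ * z₂ - x * z₁ - x * z₂ - 1) *
        (x * z₂ * z₃ + z₂ + z₃ - 1) * (x * z₃ * z₄ - x * z₃ - x * z₄ - 1) *
        AltSign.Zqua n x (x + 1) z₁ z₂ z₃ z₄ =
      z₁ * z₂ * z₃ * z₄ * (x * z₁ * z₃ + 1) * (x * z₂ * z₄ + 1) *
          ((x * z₁ + 1) * (x * z₂ + 1) * (x * z₃ + 1) * (x * z₄ + 1)) ^ (n - 2) *
          (x + 1) ^ AltSign.halfProd ((n : ℤ) - 4)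
        - ((z₂ - 1) * (z₃ - 1) * z₄ * z₁ * ((x * z₄ + 1) * (x * z₁ + 1)) ^ (n - 2)
            + (z₄ - 1) * (z₁ - 1) * z₂ * z₃ * ((x * z₂ + 1) * (x * z₃ + 1)) ^ (n - 2)) *
          (x * z₁ * z₂ - x * z₁ - x * z₂ - 1) * (x * z₃ * z₄ - x * z₃ - x * z₄ - 1) *
          (x + 1) ^ AltSign.halfProd ((n : ℤ) - 3)
        - ((z₃ - 1) * (z₄ - 1) * z₁ * z₂ * (z₃ * z₄) ^ (n - 1) *
              ((x * z₁ + 1) * (x * z₂ + 1)) ^ (n - 2)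
            + (z₁ - 1) * (z₂ - 1) * z₃ * z₄ * (z₁ * z₂) ^ (n - 1) *
              ((x * z₃ + 1) * (x * z₄ + 1)) ^ (n - 2)) *
          (x * z₄ * z₁ + z₄ + z₁ - 1) * (x * z₂ * z₃ + z₂ + z₃ - 1) *
          x ^ n * (x + 1) ^ AltSign.halfProd ((n : ℤ) - 3)
        + (z₁ - 1) * (z₂ - 1) * (z₃ - 1) * (z₄ - 1) *
          ((x * z₁ * z₂ - x * z₁ - x * z₂ - 1) * (x * z₃ * z₄ - x * z₃ - x * z₄ - 1)
            + (x * z₄ * z₁ + z₄ + z₁ - 1) * (x * z₂ * z₃ + z₂ + z₃ - 1) *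
              (z₁ * z₂ * z₃ * z₄) ^ (n - 1) * x ^ (2 * n - 1)) *
          (x + 1) ^ AltSign.halfProd ((n : ℤ) - 2)) ∧
    (2 ≤ n →
      (x * z₁ * z₃ + z₁ + z₃ - 1) * (x * z₂ * z₃ - x * z₂ - x * z₃ - 1) *
        AltSign.Ztri n x (x + 1) z₁ z₂ z₃ =
      -(z₁ * z₃ * (x * z₁ * z₂ + 1) * ((x * z₁ + 1) * (x * z₂ + 1)) ^ (n - 2) *
          (x * z₃ + 1) ^ (n - 1) * (x + 1) ^ AltSign.halfProd ((n : ℤ) - 3))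
        + (z₂ - 1) * (z₃ - 1) * (x * z₁ * z₃ + z₁ + z₃ - 1) * z₁ * (z₂ * z₃) ^ (n - 1) *
          (x * z₁ + 1) ^ (n - 2) * x ^ n * (x + 1) ^ AltSign.halfProd ((n : ℤ) - 2)
        - (z₁ - 1) * (z₃ - 1) * (x * z₂ * z₃ - x * z₂ - x * z₃ - 1) *
          (x * z₂ + 1) ^ (n - 2) * (x + 1) ^ AltSign.halfProd ((n : ℤ) - 2)) ∧
    ((x * z₁ * z₂ + z₁ + z₂ - 1) * AltSign.Zadj n x (x + 1) z₁ z₂ =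
      z₁ * z₂ * ((x * z₁ + 1) * (x * z₂ + 1)) ^ (n - 1) *
          (x + 1) ^ AltSign.halfProd ((n : ℤ) - 2)
        - (z₁ - 1) * (z₂ - 1) * (x + 1) ^ AltSign.halfProd ((n : ℤ) - 1)) := by
  refine ⟨fun h2 => ?_, fun h2 => ?_, ?_⟩
  · obtain ⟨m, rfl⟩ := Nat.exists_eq_add_of_le' h2
    have e2 : ((m + 2 : ℕ) : ℤ) - 2 = m := by push_cast; ring
    have e3 : ((m + 2 : ℕ) : ℤ) - 3 = m - 1 := by push_cast; ring
    have e4 : ((m + 2 : ℕ) : ℤ) - 4 = m - 1 - 1 := by push_cast; ring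
    rw [e2, e3, e4, show m + 2 - 2 = m from rfl, show m + 2 - 1 = m + 1 from rfl,
      show 2 * (m + 2) - 1 = 2 * m + 3 from rfl]
    exact Zqua_quadruple hx hy h₁ h₂ h₃ h₄ m
  · obtain ⟨m, rfl⟩ := Nat.exists_eq_add_of_le' h2
    have e2 : ((m + 2 : ℕ) : ℤ) - 2 = m := by push_cast; ring
    have e3 : ((m + 2 : ℕ) : ℤ) - 3 = m - 1 := by push_cast; ring
    rw [e2, e3, show m + 2 - 2 = m from rfl, show m + 2 - 1 = m + 1 from rfl]
    exact Zqua_triple hx hy h₁ h₂ h₃ m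
  · obtain ⟨m, rfl⟩ := Nat.exists_eq_add_of_le' hn
    have e1 : ((m + 1 : ℕ) : ℤ) - 1 = m := by push_cast; ring
    have e2 : ((m + 1 : ℕ) : ℤ) - 2 = m - 1 := by push_cast; ring
    rw [e1, e2, show m + 1 - 1 = m from rfl]
    exact (Zqua_adjacent hx hy h₁ h₂ m).1

end AltSign

theorem mainTheorem3 {R : Type*} [CommRing R] (n : ℕ) (hn : 1 ≤ n) (x z₁ z₂ z₃ z₄ : R) :
    (2 ≤ n →
      (x * z₄ * z₁ + z₄ + z₁ - 1) * (x * z₁ * z₂ - x * z₁ - x * z₂ - 1) *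
        (x * z₂ * z₃ + z₂ + z₃ - 1) * (x * z₃ * z₄ - x * z₃ - x * z₄ - 1) *
        AltSign.Zqua n x (x + 1) z₁ z₂ z₃ z₄ =
      z₁ * z₂ * z₃ * z₄ * (x * z₁ * z₃ + 1) * (x * z₂ * z₄ + 1) *
          ((x * z₁ + 1) * (x * z₂ + 1) * (x * z₃ + 1) * (x * z₄ + 1)) ^ (n - 2) *
          (x + 1) ^ AltSign.halfProd ((n : ℤ) - 4)
        - ((z₂ - 1) * (z₃ - 1) * z₄ * z₁ * ((x * z₄ + 1) * (x * z₁ + 1)) ^ (n - 2)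
            + (z₄ - 1) * (z₁ - 1) * z₂ * z₃ * ((x * z₂ + 1) * (x * z₃ + 1)) ^ (n - 2)) *
          (x * z₁ * z₂ - x * z₁ - x * z₂ - 1) * (x * z₃ * z₄ - x * z₃ - x * z₄ - 1) *
          (x + 1) ^ AltSign.halfProd ((n : ℤ) - 3)
        - ((z₃ - 1) * (z₄ - 1) * z₁ * z₂ * (z₃ * z₄) ^ (n - 1) *
              ((x * z₁ + 1) * (x * z₂ + 1)) ^ (n - 2)
            + (z₁ - 1) * (z₂ - 1) * z₃ * z₄ * (z₁ * z₂) ^ (n - 1) *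
              ((x * z₃ + 1) * (x * z₄ + 1)) ^ (n - 2)) *
          (x * z₄ * z₁ + z₄ + z₁ - 1) * (x * z₂ * z₃ + z₂ + z₃ - 1) *
          x ^ n * (x + 1) ^ AltSign.halfProd ((n : ℤ) - 3)
        + (z₁ - 1) * (z₂ - 1) * (z₃ - 1) * (z₄ - 1) *
          ((x * z₁ * z₂ - x * z₁ - x * z₂ - 1) * (x * z₃ * z₄ - x * z₃ - x * z₄ - 1)
            + (x * z₄ * z₁ + z₄ + z₁ - 1) * (x * z₂ * z₃ + z₂ + z₃ - 1) *
              (z₁ * z₂ * z₃ * z₄) ^ (n - 1) * x ^ (2 * n - 1)) *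
          (x + 1) ^ AltSign.halfProd ((n : ℤ) - 2)) ∧
    (2 ≤ n →
      (x * z₁ * z₃ + z₁ + z₃ - 1) * (x * z₂ * z₃ - x * z₂ - x * z₃ - 1) *
        AltSign.Ztri n x (x + 1) z₁ z₂ z₃ =
      -(z₁ * z₃ * (x * z₁ * z₂ + 1) * ((x * z₁ + 1) * (x * z₂ + 1)) ^ (n - 2) *
          (x * z₃ + 1) ^ (n - 1) * (x + 1) ^ AltSign.halfProd ((n : ℤ) - 3))
        + (z₂ - 1) * (z₃ - 1) * (x * z₁ * z₃ + z₁ + z₃ - 1) * z₁ * (z₂ * z₃) ^ (n - 1) *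
          (x * z₁ + 1) ^ (n - 2) * x ^ n * (x + 1) ^ AltSign.halfProd ((n : ℤ) - 2)
        - (z₁ - 1) * (z₃ - 1) * (x * z₂ * z₃ - x * z₂ - x * z₃ - 1) *
          (x * z₂ + 1) ^ (n - 2) * (x + 1) ^ AltSign.halfProd ((n : ℤ) - 2)) ∧
    ((x * z₁ * z₂ + z₁ + z₂ - 1) * AltSign.Zadj n x (x + 1) z₁ z₂ =
      z₁ * z₂ * ((x * z₁ + 1) * (x * z₂ + 1)) ^ (n - 1) *
          (x + 1) ^ AltSign.halfProd ((n : ℤ) - 2)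
        - (z₁ - 1) * (z₂ - 1) * (x + 1) ^ AltSign.halfProd ((n : ℤ) - 1)) := by
  -- The indeterminates and x+1 are nonzero in the fraction field of ℤ[x, z₁, …, z₄]. The identities
  -- hold there, descend to the polynomial ring by injectivity, and specialize to `R`.
  let P := MvPolynomial (Fin 5) ℤ
  let X : Fin 5 → P := MvPolynomial.X
  let ι : P →+* FractionRing P := algebraMap P (FractionRing P)
  have hι : Function.Injective ι := IsFractionRing.injective P (FractionRing P)
  have hX (i : Fin 5) : ι (X i) ≠ 0 :=
    (map_ne_zero_iff ι hι).2 (MvPolynomial.X_ne_zero i)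
  have hX1 : ι (X 0) + 1 ≠ 0 := by
    rw [← map_one ι, ← map_add, map_ne_zero_iff ι hι]
    intro h
    have := congrArg (MvPolynomial.eval fun _ => (1 : ℤ)) h
    simp [X] at this
  let φ : P →+* R := MvPolynomial.eval₂Hom (Int.castRingHom R) ![x, z₁, z₂, z₃, z₄]
  have h0 : φ (X 0) = x := MvPolynomial.eval₂Hom_X' _ _ 0
  have h1 : φ (X 1) = z₁ := MvPolynomial.eval₂Hom_X' _ _ 1
  have h2 : φ (X 2) = z₂ := MvPolynomial.eval₂Hom_X' _ _ 2
  have h3 : φ (X 3) = z₃ := MvPolynomial.eval₂Hom_X' _ _ 3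
  have h4 : φ (X 4) = z₄ := MvPolynomial.eval₂Hom_X' _ _ 4
  obtain ⟨hq, ht, ha⟩ := AltSign.Zqua_Ztri_Zadj_of_ne_zero n hn (hX 0) hX1 (hX 1) (hX 2) (hX 3) (hX 4)
  refine ⟨fun hn2 => ?_, fun hn2 => ?_, ?_⟩
  · have h := hq hn2
    simp only [← map_one ι, ← map_mul, ← map_add, ← map_sub, ← map_pow,
      ← AltSign.map_Zqua] at h
    have h' := congrArg φ (hι h)
    simpa only [map_one, map_mul, map_add, map_sub, map_pow, AltSign.map_Zqua, h0, h1, h2, h3,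
      h4] using h'
  · have h := ht hn2
    simp only [AltSign.Ztri, ← map_one ι, ← map_mul, ← map_add, ← map_sub, ← map_pow, ← map_neg,
      ← AltSign.map_Zqua] at h
    have h' := congrArg φ (hι h)
    rw [AltSign.Ztri]
    simpa only [map_one, map_mul, map_add, map_sub, map_pow, map_neg, AltSign.map_Zqua, h0, h1, h2, h3,
      h4] using h'
  · have h := ha
    simp only [AltSign.Zadj, ← map_one ι, ← map_mul, ← map_add, ← map_sub, ← map_pow,
      ← AltSign.map_Zqua] at h
    have h' := congrArg φ (hι h)
    rw [AltSign.Zadj]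
    simpa only [map_one, map_mul, map_add, map_sub, map_pow, AltSign.map_Zqua, h0, h1, h2, h3,
      h4] using h'
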